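/- Let $F$ be a non-archimedean local field with ring of integers $\mathcal O_F$, uniformizer $\varpi$ and residue field $k_F$ of cardinality $q=p^n$, $p$ prime; fix an algebraic closure $\bar{\mathbb F}_p$ of $\mathbb F_p$ and an embedding $k_F\hookrightarrow\bar{\mathbb F}_p$. Put $G=\mathrm{SL}_2(F)$, $K_0=\mathrm{SL}_2(\mathcal O_F)$, $\alpha_0=\mathrm{diag}(\varpi^{-1},\varpi)$, $w_0=\begin{pmatrix}0&-1\\1&0\end{pmatrix}$, and let $I(1)\subset K_0$ be the subgroup of matrices that are upper unipotent modulo $\varpi$. For $r=(r_0,\dots,r_{n-1})\in\{0,\dots,p-1\}^n$ let $\sigma_r=\bigotimes_{i=0}^{n-1}\mathrm{Sym}^{r_i}\bar{\mathbb F}_p^2$ be the weight on which $\begin{pmatrix}a&b\\c&d\end{pmatrix}\in K_0$ acts on the $i$-th factor (homogeneous polynomials of degree $r_i$ in $X,Y$) by $X\mapsto \bar a^{p^i}X+\bar c^{p^i}Y$, $Y\mapsto \bar b^{p^i}X+\bar d^{p^i}Y$. Let $\mathrm{ind}_{K_0}^{G}(\sigma_r)$ be the compact induction: the smooth functions $f:G\to\sigma_r$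 with $f(hg)=\sigma_r(h)f(g)$ for $h\in K_0$, with finite support modulo $K_0$, on which $G$ acts by right translation. It is a left module over the spherical Hecke algebra $\mathcal H=\mathrm{End}_{G}(\mathrm{ind}_{K_0}^{G}(\sigma_r))$. Then: 1. $\mathrm{ind}_{K_0}^{G}(\sigma_r)$ is a free $\mathcal H$-module of infinite rank. 2. $\mathcal H=\bar{\mathbb F}_p[\tau]$ is a polynomial algebra in one variable, generated by the operator $\tau$ that is given on the standard functions $[g,v]$ (supported on $K_0g^{-1}$, with $[g,v](x)=\sigma_r(xg)v$ there) by $$\tau[g,v]=\sum_{\lambda\in k_F^2}\Big[g\begin{pmatrix}1&A(\lambda)\\0&1\end{pmatrix}\alpha_0^{-1},\ w_0U_r\begin{pmatrix}0&1\\-1&A(\lambda)\end{pmatrix}v\Big]+\sum_{\mu\in k_F}\Big[g\begin{pmatrix}1&0\\\varpi A(\mu)&1\end{pmatrix}\alpha_0,\ U_rv\Big],$$ where $A(\lambda_0,\lambda_1)=[\lambda_0]+[\lambda_1]\varpi$ and $A(\mu)=[\mu]$ for any system $[\cdot]$ of representatives of $k_F$ in $\mathcal O_F$ (for instance the Teichmüller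 lifts), and $U_r=\bigotimes_i U_{r_i}$ with $U_{r_i}(Y^{r_i})=Y^{r_i}$ and $U_{r_i}(X^lY^{r_i-l})=0$ for $l\neq0$. 3. There is an $\mathcal H$-basis of $\mathrm{ind}_{K_0}^{G}(\sigma_r)$ of the form $\bigcup_{m\ge0}A_m$ with non-empty subsets $A_m\subset C_m$, where $C_m$ is the sum of the spaces of functions supported on $K_0\alpha_0^{m}I(1)$ and on $K_0\alpha_0^{-m}I(1)$, i.e. the space of functions supported on the sphere of radius $2m$ around the central vertex of the Bruhat–Tits tree. -/

import Mathlib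

open scoped ValuativeRel TensorProduct
open Matrix

namespace ModPSL2

/-! ### Compact induction and its endomorphism algebra -/

section CompactInduction

variable {k H G W : Type*} [Field k] [Group H] [Group G] [TopologicalSpace G]
  [IsTopologicalGroup G] [AddCommGroup W] [Module k W]

/-- The compact induction `ind_H^G(σ)` of a representation `σ` of `H`, where `H` is regarded as a
subgroup of `G` through an injective homomorphism `φ : H →* G` with open image. Its elements are the
functions `f : G → W` with `f (h g) = σ(h) (f g)` that are fixed by some open subgroup of `G`
and whose support has finite image in `H \ G`; `G` acts by right translation. -/
noncomputable def cInd (φ : H →* G) (σ : Representation k H W) :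
    Subrepresentation (Representation.coind φ σ) where
  toSubmodule :=
    { carrier := {f |
        (∃ U : Subgroup G, IsOpen (U : Set G) ∧ ∀ u ∈ U, Representation.coind φ σ u f = f) ∧
        (Quotient.mk (QuotientGroup.rightRel φ.range) ''
          Function.support (f : G → W)).Finite}
      zero_mem' := by
        refine ⟨⟨⊤, isOpen_univ, fun u _ => map_zero _⟩, ?_⟩
        simp
      add_mem' := by
        rintro f f' ⟨⟨U, hU, hf⟩, hs⟩ ⟨⟨U', hU', hf'⟩, hs'⟩
        refine ⟨⟨U ⊓ U', hU.inter hU', fun u hu => ?_⟩, ?_⟩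
        · rw [map_add, hf u hu.1, hf' u hu.2]
        · refine (hs.union hs').subset ?_
          rw [← Set.image_union]
          exact Set.image_mono (Function.support_add _ _)
      smul_mem' := by
        rintro c f ⟨⟨U, hU, hf⟩, hs⟩
        refine ⟨⟨U, hU, fun u hu => by rw [map_smul, hf u hu]⟩, hs.subset ?_⟩
        exact Set.image_mono (Function.support_const_smul_subset c (f : G → W)) }
  apply_mem_toSubmodule := by
    rintro g f ⟨⟨U, hU, hf⟩, hs⟩
    constructor
    · refine ⟨U.comap (MulAut.conj g⁻¹).toMonoidHom, ?_, ?_⟩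
      · have hc : Continuous fun x : G => g⁻¹ * x * g := by fun_prop
        have : ((U.comap (MulAut.conj g⁻¹).toMonoidHom : Subgroup G) : Set G)
            = (fun x : G => g⁻¹ * x * g) ⁻¹' (U : Set G) := by
          ext x
          simp
        rw [this]
        exact hU.preimage hc
      · intro u hu
        have hu' : g⁻¹ * u * g ∈ U := by simpa using hu
        have h1 := hf _ hu'
        rw [← Module.End.mul_apply, ← map_mul,
          show u * g = g * (g⁻¹ * u * g) by group, map_mul, Module.End.mul_apply, h1]
    · let T : Quotient (QuotientGroup.rightRel φ.range) →
          Quotient (QuotientGroup.rightRel φ.range) :=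
        Quotient.map (fun x => x * g⁻¹) (by
          intro x y hxy
          change QuotientGroup.rightRel φ.range _ _ at hxy
          change QuotientGroup.rightRel φ.range _ _
          rw [QuotientGroup.rightRel_apply] at hxy ⊢
          simpa [mul_assoc] using hxy)
      refine (hs.image T).subset ?_
      rintro _ ⟨x, hx, rfl⟩
      refine ⟨_, ⟨x * g, ?_, rfl⟩, ?_⟩
      · exact hx
      · simp [T]

/-- The underlying space of the compact induction. -/
noncomputable abbrev CInd (φ : H →* G) (σ : Representation k H W) : Type _ := (cInd φ σ).toSubmodule

/-- The Hecke algebra `End_G (ind_H^G σ)`, with composition as multiplication. -/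
abbrev HeckeAlgebra (φ : H →* G) (σ : Representation k H W) : Type _ :=
  Representation.IntertwiningMap (cInd φ σ).toRepresentation (cInd φ σ).toRepresentation

/-- The compact induction as a left module over its endomorphism algebra: `T • f = T f`. -/
noncomputable instance (φ : H →* G) (σ : Representation k H W) : Module (HeckeAlgebra φ σ) (CInd φ σ) where
  smul T f := T f
  one_smul _ := rfl
  mul_smul _ _ _ := rfl
  smul_zero T := map_zero T
  smul_add T := map_add T
  add_smul _ _ _ := rfl
  zero_smul _ := rfl

open Classical in
/-- The standard function `[g, v]`: it is supported on `H g⁻¹` and its value at `x ∈ H g⁻¹` is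
`σ(x g) v`. -/
noncomputable def stdFun (φ : H →* G) (σ : Representation k H W) (g : G) (v : W) : G → W :=
  fun x => if h : ∃ a : H, φ a = x * g then σ h.choose v else 0

/-- The functions in the compact induction whose support is contained in `S`. -/
noncomputable def supportedOn (φ : H →* G) (σ : Representation k H W) (S : Set G) :
    Submodule k (CInd φ σ) where
  carrier := {f | ∀ x, x ∉ S → f.1.1 x = 0}
  zero_mem' := fun _ _ => rfl
  add_mem' := by
    intro f f' hf hf' x hx
    have h1 := hf x hx
    have h2 := hf' x hx
    simp [h1, h2]
  smul_mem' := by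
    intro c f hf x hx
    have h1 := hf x hx
    simp [h1]

end CompactInduction

/-! ### The weights `Sym^r` -/

section Weights

variable {k : Type*} [Field k]

/-- `Sym^d k²`: homogeneous polynomials of degree `d` in `X = X 0` and `Y = X 1`. -/
abbrev SymPow (k : Type*) [Field k] (d : ℕ) : Type _ :=
  MvPolynomial.homogeneousSubmodule (Fin 2) k d

/-- The substitution `X ↦ a X + c Y`, `Y ↦ b X + d Y` attached to the matrix `(a, b; c, d)`. -/
noncomputable def subst (M : Matrix (Fin 2) (Fin 2) k) :
    MvPolynomial (Fin 2) k →ₐ[k] MvPolynomial (Fin 2) k :=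
  MvPolynomial.aeval fun j => ∑ i, MvPolynomial.C (M i j) * MvPolynomial.X i

/-- The representation `Sym^d k²` of `SL₂(k)`. -/
noncomputable def symRep (k : Type*) [Field k] (d : ℕ) :
    Representation k (SpecialLinearGroup (Fin 2) k) (SymPow k d) where
  toFun g := (subst (g : Matrix (Fin 2) (Fin 2) k)).toLinearMap.restrict (by
    intro f hf
    have h := MvPolynomial.IsHomogeneous.aeval (n := 1) hf
      (fun j => ∑ i, MvPolynomial.C ((g : Matrix (Fin 2) (Fin 2) k) i j) * MvPolynomial.X i)
      (fun j => MvPolynomial.IsHomogeneous.sum _ _ _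
        fun i _ => MvPolynomial.isHomogeneous_C_mul_X _ i)
    rw [one_mul] at h
    exact h)
  map_one' := by
    ext1 f
    apply Subtype.ext
    have : subst (1 : Matrix (Fin 2) (Fin 2) k) = AlgHom.id k _ := by
      refine MvPolynomial.algHom_ext fun j => ?_
      fin_cases j <;> simp [subst]
    change subst (1 : Matrix (Fin 2) (Fin 2) k) f.1 = f.1
    rw [this, AlgHom.id_apply]
  map_mul' g h := by
    ext1 f
    apply Subtype.ext
    have : subst ((g : Matrix (Fin 2) (Fin 2) k) * (h : Matrix (Fin 2) (Fin 2) k))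
        = (subst (g : Matrix (Fin 2) (Fin 2) k)).comp (subst (h : Matrix (Fin 2) (Fin 2) k)) := by
      refine MvPolynomial.algHom_ext fun j => ?_
      simp only [subst, AlgHom.comp_apply, MvPolynomial.aeval_X, Fin.sum_univ_two,
        Matrix.mul_apply, map_add, map_mul, MvPolynomial.aeval_C, MvPolynomial.algebraMap_eq]
      ring
    change subst ((g : Matrix (Fin 2) (Fin 2) k) * (h : Matrix (Fin 2) (Fin 2) k)) f.1
      = subst (g : Matrix (Fin 2) (Fin 2) k) (subst (h : Matrix (Fin 2) (Fin 2) k) f.1)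
    rw [this, AlgHom.comp_apply]

/-- The endomorphism of `Sym^d k²` with `Y^d ↦ Y^d` and `X^l Y^(d-l) ↦ 0` for `l ≠ 0`. -/
noncomputable def symU (k : Type*) [Field k] (d : ℕ) : SymPow k d →ₗ[k] SymPow k d :=
  ((MvPolynomial.lcoeff (R := k) (Finsupp.single (1 : Fin 2) d)).comp
    (Submodule.subtype _)).smulRight
    ⟨MvPolynomial.X 1 ^ d, MvPolynomial.isHomogeneous_X_pow _ _⟩

/-- The space `Sym^{r₀} k² ⊗ ⋯ ⊗ Sym^{r_{n-1}} k²`. -/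
def WeightSpace (k : Type*) [Field k] {n : ℕ} (r : Fin n → ℕ) : Type _ :=
  ⨂[k] i, SymPow k (r i)

noncomputable instance {n : ℕ} (r : Fin n → ℕ) : AddCommGroup (WeightSpace k r) :=
  inferInstanceAs (AddCommGroup (⨂[k] i, SymPow k (r i)))

noncomputable instance {n : ℕ} (r : Fin n → ℕ) : Module k (WeightSpace k r) :=
  inferInstanceAs (Module k (⨂[k] i, SymPow k (r i)))

/-- The operator `U_{r₀} ⊗ ⋯ ⊗ U_{r_{n-1}}`. -/
noncomputable def weightU (k : Type*) [Field k] {n : ℕ} (r : Fin n → ℕ) :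
    WeightSpace k r →ₗ[k] WeightSpace k r :=
  PiTensorProduct.map fun i => symU k (r i)

end Weights

/-! ### The groups -/

section Groups

variable (F : Type*) [Field F] [ValuativeRel F] [TopologicalSpace F]
  [IsNonarchimedeanLocalField F]

/-- `K₀ = SL₂(𝒪_F)`. -/
abbrev K0 : Type _ := SpecialLinearGroup (Fin 2) 𝒪[F]

/-- `SL₂(F)`. -/
abbrev GS : Type _ := SpecialLinearGroup (Fin 2) F

/-- The inclusion `SL₂(𝒪_F) → SL₂(F)`. -/
noncomputable def incl : K0 F →* GS F := SpecialLinearGroup.map (algebraMap 𝒪[F] F)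

variable {F}

/-- The weight `σ_r = Sym^{r₀} k² ⊗ ⋯ ⊗ Sym^{r_{n-1}} k²` of `SL₂(𝒪_F)`, for an embedding `ι` of the
residue field in `k`: a matrix is reduced modulo the maximal ideal and acts on the `i`-th tensor
factor through the `p^i`-th powers of its entries. -/
noncomputable def weight (p : ℕ) [Fact p.Prime] [CharP 𝓀[F] p] {k : Type*} [Field k]
    (ι : 𝓀[F] →+* k) {n : ℕ} (r : Fin n → ℕ) :
    Representation k (K0 F) (WeightSpace k r) :=
  PiTensorProduct.mapMonoidHom.comp <| MonoidHom.pi fun i =>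
    (symRep k (r i)).comp <|
      SpecialLinearGroup.map
        ((ι.comp (iterateFrobenius 𝓀[F] p i)).comp (IsLocalRing.residue 𝒪[F]))

/-- The upper unipotent matrix `(1, x; 0, 1)`. -/
def upper {R : Type*} [CommRing R] (x : R) : SpecialLinearGroup (Fin 2) R :=
  ⟨!![1, x; 0, 1], by simp⟩

/-- The lower unipotent matrix `(1, 0; x, 1)`. -/
def lower {R : Type*} [CommRing R] (x : R) : SpecialLinearGroup (Fin 2) R :=
  ⟨!![1, 0; x, 1], by simp⟩

/-- The matrix `w₀ = (0, -1; 1, 0)`. -/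
def w0 {R : Type*} [CommRing R] : SpecialLinearGroup (Fin 2) R :=
  ⟨!![0, -1; 1, 0], by simp⟩

/-- The matrix `(0, 1; -1, x)`. -/
def w0u {R : Type*} [CommRing R] (x : R) : SpecialLinearGroup (Fin 2) R :=
  ⟨!![0, 1; -1, x], by simp⟩

/-- `α₀ = diag(ϖ⁻¹, ϖ)`, for a uniformizer `ϖ`. -/
noncomputable def alpha0 {ϖ : 𝒪[F]} (hϖ : Irreducible ϖ) : GS F :=
  ⟨!![(ϖ : F)⁻¹, 0; 0, (ϖ : F)], by
    have h : (ϖ : F) ≠ 0 := fun h => hϖ.ne_zero (Subtype.ext h)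
    simp [h]⟩

variable (F) in
/-- The pro-`p`-Iwahori subgroup `I_S(1)`, as a subset of `SL₂(𝒪_F)`: the matrices that are upper
unipotent modulo the maximal ideal. -/
def proPIwahori : Set (K0 F) := {g | g 0 0 - 1 ∈ 𝓂[F] ∧ g 1 0 ∈ 𝓂[F] ∧ g 1 1 - 1 ∈ 𝓂[F]}

/-- The double coset `K₀ α₀^m I_S(1)`. -/
def cell {ϖ : 𝒪[F]} (hϖ : Irreducible ϖ) (m : ℤ) : Set (GS F) :=
  {x | ∃ a : K0 F, ∃ b ∈ proPIwahori F, x = incl F a * alpha0 hϖ ^ m * incl F b}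

/-- The space `C_m`: the sum of the spaces of functions in the compact induction supported on
`K₀ α₀^m I_S(1)` and on `K₀ α₀^(-m) I_S(1)`. These are the functions supported on the vertices at
distance `2 m` from the central vertex of the Bruhat-Tits tree. -/
noncomputable def sphere {k W : Type*} [Field k] [AddCommGroup W] [Module k W]
    (σ : Representation k (K0 F) W) {ϖ : 𝒪[F]} (hϖ : Irreducible ϖ)
    (m : ℕ) : Submodule k (CInd (incl F) σ) :=
  supportedOn (incl F) σ (cell hϖ m) ⊔ supportedOn (incl F) σ (cell hϖ (-(m : ℤ)))

/-- `τ` is the standard spherical Hecke operator for the weight `σ_r`: with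
`A(λ) = [λ₀] + [λ₁] ϖ` for `λ ∈ k_F²` and `A(μ) = [μ]` for `μ ∈ k_F`, where `[·]` is the system of
representatives `s` of the residue field, every standard function satisfies
`τ [g, v] = ∑_λ [g (1, A(λ); 0, 1) α₀⁻¹, w₀ U_r (0, 1; -1, A(λ)) v]`
`+ ∑_μ [g (1, 0; ϖ A(μ), 1) α₀, U_r v]`. -/
def IsHeckeOperator (p : ℕ) [Fact p.Prime] [CharP 𝓀[F] p] {k : Type*} [Field k]
    (ι : 𝓀[F] →+* k) {n : ℕ} (r : Fin n → ℕ) {ϖ : 𝒪[F]} (hϖ : Irreducible ϖ) (s : 𝓀[F] → 𝒪[F])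
    (τ : HeckeAlgebra (incl F) (weight p ι r)) : Prop :=
  ∀ (g : GS F) (v : WeightSpace k r), ∃ f : CInd (incl F) (weight p ι r),
    f.1.1 = stdFun (incl F) (weight p ι r) g v ∧
    (τ f).1.1 =
      (∑ᶠ l : 𝓀[F] × 𝓀[F], stdFun (incl F) (weight p ι r)
        (g * incl F (upper (s l.1 + s l.2 * ϖ)) * (alpha0 hϖ)⁻¹)
        (weight p ι r w0 (weightU k r (weight p ι r (w0u (s l.1 + s l.2 * ϖ)) v)))) +
      ∑ᶠ m : 𝓀[F], stdFun (incl F) (weight p ι r)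
        (g * incl F (lower (ϖ * s m)) * alpha0 hϖ) (weightU k r v)

end Groups

end ModPSL2

/-!
# The spherical Hecke algebra of `SL₂(F)` in characteristic `p`

Write `V` for the compact induction of the weight `σ_r`. It is filtered by the
functions supported in the balls of the Bruhat-Tits tree around the central
vertex: `ballFil m` consists of the functions of level less than `m`, that is, supported on those
`x` for which `ϖ^j x` is integral for some `j < m`.

The operator `τ` is convolution with the function on `K₀ α₀ K₀` that sends `g` to the action of
the singular matrix `ϖ g` modulo `ϖ` (`heckeOperator`). Choosing coset representatives turns this
into the explicit formula (`isHeckeOperator_heckeOperator`). It maps `ballFil m` to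
`ballFil (m + 1)`. Let `f ∈ ballFil (m + 1)`. Among the vertices at distance two from a vertex of level `m + 1`,
exactly one has level at most `m`. So the value of `τ f` there only involves the value of `f` at
this parent `x`, and the values of `τ f` at the children of `x` are `U_r (σ_r(lower t) (f x))` for
varying `t`. Together these determine `f x`: the functions `t ↦ t^e` on the residue field, with
`e < q` the exponents of the monomial basis of the weight, are linearly independent. Hence `τ` is
strict, `τ f ∈ ballFil (m + 1)` implies `f ∈ ballFil m` (`mem_ballFil_of_heckeOperator`). On the
other hand `ballFil m + τ (ballFil m)` is a proper subspace of `ballFil (m + 1)`, because these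
values depend on `t` only modulo `ϖ` (`ballFil_sup_map_ne`).

Linear algebra does the rest for the module structure: choosing for every `m` a basis of a
complement of `ballFil m + τ (ballFil m)` in `ballFil (m + 1)` that consists of functions
supported on the sphere gives a basis of `V` over the polynomial ring in `τ` (`exists_generators`,
`exists_basis_of_polynomial`).

Finally, a Hecke operator `T` is determined by its values `symbol T x` at the standard functions
`[1, v]`, which are endomorphisms of the weight. By equivariance, the symbol at `α₀^(-m)` with
`m ≥ 1` is invariant under lower unipotent matrices on the left and upper unipotent matrices on the
right, hence a multiple of `U_r`; for `m = 0` it is a scalar. The symbol of `τ^m` at `α₀^(-m)`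
does not vanish, so every Hecke operator is a polynomial in `τ`, by subtracting multiples of
powers of `τ` to lower its level (`aeval_heckeOperator_surjective`).
-/

namespace ModPSL2

/-! ### Filtered modules over a polynomial ring -/

section Filtered

variable {k V : Type*} [Field k] [AddCommGroup V] [Module k V]

theorem strict_of_mem {Fil : ℕ → Submodule k V} (hmono : Monotone Fil)
    (hexh : ∀ v, ∃ m, v ∈ Fil m) {τ : Module.End k V}
    (hstrict : ∀ m, ∀ v ∈ Fil (m + 1), τ v ∈ Fil (m + 1) → v ∈ Fil m)
    {m : ℕ} {v : V} (h : τ v ∈ Fil (m + 1)) : v ∈ Fil m := by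
  obtain ⟨M, hM⟩ := hexh v
  induction M with
  | zero => exact hmono (Nat.zero_le _) hM
  | succ M ih =>
    rcases Nat.lt_or_ge M m with hlt | hge
    · exact hmono hlt hM
    · exact ih (hstrict M v hM (hmono (by omega) h))

theorem injective_of_strict {Fil : ℕ → Submodule k V} (hzero : Fil 0 = ⊥) (hmono : Monotone Fil)
    (hexh : ∀ v, ∃ m, v ∈ Fil m) {τ : Module.End k V}
    (hstrict : ∀ m, ∀ v ∈ Fil (m + 1), τ v ∈ Fil (m + 1) → v ∈ Fil m) :
    Function.Injective τ := by
  refine (injective_iff_map_eq_zero τ).2 fun v hv => ?_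
  have : v ∈ Fil 0 := strict_of_mem hmono hexh hstrict (by rw [hv]; exact zero_mem _)
  rwa [hzero, Submodule.mem_bot] at this

/-- Vectors that are linearly independent modulo the image of an injective operator `τ` are linearly
independent over `k[τ]`. -/
theorem eq_zero_of_sum_aeval_eq_zero {τ : Module.End k V} (hinj : Function.Injective τ)
    {A : Set V}
    (hind : ∀ c ∈ Finsupp.supported k k A, ∀ v : V,
      Finsupp.linearCombination k id c = τ v → c = 0)
    (s : Finset V) (hs : (s : Set V) ⊆ A) (P : V → Polynomial k)
    (hP : ∑ a ∈ s, Polynomial.aeval τ (P a) a = 0) : ∀ a ∈ s, P a = 0 := by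
  obtain ⟨N, hN⟩ : ∃ N, ∀ a ∈ s, (P a).natDegree < N :=
    ⟨s.sup (fun a => (P a).natDegree) + 1, fun a ha =>
      Nat.lt_succ_of_le (Finset.le_sup (f := fun a => (P a).natDegree) ha)⟩
  induction N generalizing P with
  | zero => exact fun a ha => absurd (hN a ha) (Nat.not_lt_zero _)
  | succ N ih =>
    -- Split off the constant terms, which vanish by independence modulo the image of `τ`.
    have key : ∀ a, Polynomial.aeval τ (P a) a
        = τ (Polynomial.aeval τ (P a).divX a) + (P a).coeff 0 • a := by
      intro a
      conv_lhs => rw [← Polynomial.divX_mul_X_add (P a), mul_comm]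
      simp only [map_add, map_mul, Polynomial.aeval_X, Polynomial.aeval_C, LinearMap.add_apply,
        Module.End.mul_apply, Module.algebraMap_end_apply]
    have hsum : τ (∑ a ∈ s, Polynomial.aeval τ (P a).divX a)
        + ∑ a ∈ s, (P a).coeff 0 • a = 0 := by
      rw [map_sum, ← Finset.sum_add_distrib, ← hP]
      exact Finset.sum_congr rfl fun a _ => (key a).symm
    classical
    have hc : (Finsupp.indicator s fun a _ => (P a).coeff 0) = 0 := by
      refine hind _ ((Finset.coe_subset.2 (Finsupp.support_indicator_subset _ _)).trans hs)
        (-∑ a ∈ s, Polynomial.aeval τ (P a).divX a) ?_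
      rw [map_neg, eq_neg_iff_add_eq_zero, add_comm, ← hsum, Finsupp.linearCombination_apply,
        Finsupp.sum_of_support_subset _ (Finsupp.support_indicator_subset _ _) _ (by simp)]
      congr 1
      exact Finset.sum_congr rfl fun a ha => by rw [Finsupp.indicator_of_mem ha, id]
    have hc' : ∀ a ∈ s, (P a).coeff 0 = 0 := fun a ha => by
      have := DFunLike.congr_fun hc a
      rwa [Finsupp.indicator_of_mem ha] at this
    have hq : ∑ a ∈ s, Polynomial.aeval τ (P a).divX a = 0 := by
      refine hinj ?_
      rw [Finset.sum_eq_zero (f := fun a => (P a).coeff 0 • a)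
        (fun a ha => by rw [hc' a ha, zero_smul]), add_zero] at hsum
      rw [hsum, map_zero]
    by_cases hN0 : N = 0
    · intro a ha
      have h1 := hN a ha
      rw [Polynomial.eq_C_of_natDegree_eq_zero (p := P a) (by omega), hc' a ha, map_zero]
    · have h0 := ih (fun a => (P a).divX) hq fun a ha => by
        have h1 := hN a ha
        rw [Polynomial.natDegree_divX_eq_natDegree_tsub_one]
        omega
      intro a ha
      rw [← Polynomial.divX_mul_X_add (P a), h0 a ha, hc' a ha]
      simp

/-- Let `Fil` be an exhaustive filtration that `τ` shifts strictly by one step, and let `C m`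
generate `Fil (m + 1)` together with `Fil m`. Then there are linearly independent subsets `A m` of
`C m` whose union is independent modulo the image of `τ`, and generates under `τ`. The set `A m`
is a basis of a complement of `Fil m + τ (Fil m)` in `Fil (m + 1)` that is contained in `C m`. -/
theorem exists_generators {Fil C : ℕ → Submodule k V} (hzero : Fil 0 = ⊥) (hmono : Monotone Fil)
    (hexh : ∀ v, ∃ m, v ∈ Fil m) (hC : ∀ m, Fil m ⊔ C m = Fil (m + 1))
    {τ : Module.End k V} (hshift : ∀ m, ∀ v ∈ Fil m, τ v ∈ Fil (m + 1))
    (hstrict : ∀ m, ∀ v ∈ Fil (m + 1), τ v ∈ Fil (m + 1) → v ∈ Fil m)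
    (hproper : ∀ m, Fil m ⊔ (Fil m).map τ ≠ Fil (m + 1)) :
    ∃ A : ℕ → Set V, (∀ m, (A m).Nonempty ∧ A m ⊆ C m) ∧ (∀ m, ∀ a ∈ A m, a ∉ Fil m) ∧
      (∀ c ∈ Finsupp.supported k k (⋃ m, A m), ∀ v : V,
        Finsupp.linearCombination k id c = τ v → c = 0) ∧
      ∀ S : Submodule k V, (∀ v ∈ S, τ v ∈ S) → (⋃ m, A m) ⊆ (S : Set V) → S = ⊤ := by
  have hexD : ∀ m, ∃ D : Submodule k V, D ≤ C m ∧ Disjoint (Fil m ⊔ (Fil m).map τ) D ∧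
      (Fil m ⊔ (Fil m).map τ) ⊔ D = Fil (m + 1) := by
    intro m
    obtain ⟨D, hD⟩ := Submodule.exists_isCompl ((C m ⊓ (Fil m ⊔ (Fil m).map τ)).submoduleOf (C m))
    refine ⟨D.map (C m).subtype, Submodule.map_subtype_le _ _, ?_, ?_⟩
    · rw [Submodule.disjoint_def]
      rintro x hx ⟨y, hy, rfl⟩
      have h0 : y ∈ (⊥ : Submodule k (C m)) :=
        hD.disjoint.le_bot ⟨⟨y.2, hx⟩, hy⟩
      rw [(Submodule.mem_bot k).1 h0, map_zero]
    · apply le_antisymm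
      · refine sup_le (sup_le (hmono (Nat.le_succ m))
          (Submodule.map_le_iff_le_comap.2 (hshift m))) ?_
        exact (Submodule.map_subtype_le _ _).trans ((hC m) ▸ le_sup_right)
      · rw [← hC m]
        refine sup_le (le_sup_left.trans le_sup_left) fun x hx => ?_
        have hxt : (⟨x, hx⟩ : C m) ∈
            (C m ⊓ (Fil m ⊔ (Fil m).map τ)).submoduleOf (C m) ⊔ D := by
          rw [hD.sup_eq_top]; trivial
        obtain ⟨y, hy, z, hz, hyz⟩ := Submodule.mem_sup.1 hxt
        refine Submodule.mem_sup.2 ⟨y, hy.2, z, ⟨z, hz, rfl⟩, congrArg Subtype.val hyz⟩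
  choose D hDC hDdisj hDsup using hexD
  let b := fun m => Module.Basis.ofVectorSpace k (D m)
  let A : ℕ → Set V := fun m => Set.range fun i => ((b m i : D m) : V)
  have hAD : ∀ m, A m ⊆ D m := by
    rintro m _ ⟨i, rfl⟩
    exact (b m i).2
  have hspan : ∀ m, Submodule.span k (A m) = D m := by
    intro m
    have : A m = (D m).subtype '' Set.range (b m) := by
      rw [← Set.range_comp]; rfl
    rw [this, Submodule.span_image, (b m).span_eq, Submodule.map_subtype_top]
  have hlin : ∀ m, LinearIndepOn k id (A m) := fun m =>
    ((b m).linearIndependent.map' (D m).subtype (Submodule.ker_subtype _)).linearIndepOn_id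
  have hAFil : ∀ m, ∀ a ∈ A m, a ∉ Fil m := by
    intro m a ha haF
    have h0 : a = 0 := (Submodule.disjoint_def.1 (hDdisj m)) a (Submodule.mem_sup_left haF)
      (hAD m ha)
    exact (hlin m).ne_zero ha h0
  have hAsucc : ∀ m, A m ⊆ Fil (m + 1) := fun m =>
    (hAD m).trans ((hDC m).trans ((hC m) ▸ le_sup_right))
  refine ⟨A, fun m => ⟨?_, (hAD m).trans (hDC m)⟩, hAFil, ?_, ?_⟩
  · by_contra hne
    rw [Set.not_nonempty_iff_eq_empty] at hne
    have : D m = ⊥ := by rw [← hspan m, hne, Submodule.span_empty]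
    refine hproper m ?_
    rw [← hDsup m, this, sup_bot_eq]
  · -- By descending induction on the top degree in which a coefficient is nonzero.
    intro c hcA v hcv
    have main : ∀ M, (∀ a, c a ≠ 0 → ∃ m < M, a ∈ A m) → c = 0 := by
      intro M
      induction M with
      | zero =>
        intro h
        ext a
        by_contra ha
        obtain ⟨m, hm, -⟩ := h a ha
        exact Nat.not_lt_zero _ hm
      | succ M ih =>
        intro h
        classical
        have hsplit := Finsupp.filter_add_filter_not c fun a => a ∈ A M
        set c₁ := c.filter fun a => a ∈ A M with hc₁
        set c₂ := c.filter fun a => ¬ a ∈ A M with hc₂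
        have hmem₁ : Finsupp.linearCombination k id c₁
            ∈ D M := by
          rw [Finsupp.linearCombination_apply]
          refine Submodule.sum_mem _ fun a ha => Submodule.smul_mem _ _ (hAD M ?_)
          exact (Finsupp.mem_support_iff.1 ha |> fun h' => by
            by_contra hn; exact h' (Finsupp.filter_apply_neg _ _ hn))
        have hmem₂ : Finsupp.linearCombination k id c₂
            ∈ Fil M := by
          rw [Finsupp.linearCombination_apply]
          refine Submodule.sum_mem _ fun a ha => Submodule.smul_mem _ _ ?_
          have ha' : ¬ a ∈ A M := by
            by_contra hn
            exact Finsupp.mem_support_iff.1 ha (Finsupp.filter_apply_neg _ _ (not_not.2 hn))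
          have hca : c a ≠ 0 := by
            have := Finsupp.mem_support_iff.1 ha
            rwa [hc₂, Finsupp.filter_apply_pos (fun a => a ∉ A M) c ha'] at this
          obtain ⟨m, hm, ham⟩ := h a hca
          have hmM : m ≠ M := fun e => ha' (e ▸ ham)
          exact hmono (by omega : m + 1 ≤ M) (hAsucc m ham)
        have hτv : τ v ∈ Fil (M + 1) := by
          rw [← hcv, ← hsplit, map_add]
          refine add_mem ?_ (hmono (Nat.le_succ M) hmem₂)
          exact ((hDC M).trans ((hC M) ▸ le_sup_right)) hmem₁
        have hv := strict_of_mem hmono hexh hstrict hτv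
        have hzero₁ : Finsupp.linearCombination k id c₁ = 0 := by
          refine (Submodule.disjoint_def.1 (hDdisj M)) _ ?_ hmem₁
          have : Finsupp.linearCombination k id c₁
              = -Finsupp.linearCombination k id c₂ + τ v := by
            rw [← hcv, ← hsplit, map_add]; abel
          rw [this]
          exact add_mem (Submodule.mem_sup_left (neg_mem hmem₂))
            (Submodule.mem_sup_right ⟨v, hv, rfl⟩)
        have hc₁0 : c₁ = 0 := linearIndepOn_iff.1 (hlin M) c₁ (fun a ha => by
          by_contra hn
          exact Finsupp.mem_support_iff.1 ha (Finsupp.filter_apply_neg _ _ hn)) hzero₁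
        refine ih fun a ha => ?_
        obtain ⟨m, hm, ham⟩ := h a ha
        rcases Nat.lt_succ_iff_lt_or_eq.1 hm with hlt | rfl
        · exact ⟨m, hlt, ham⟩
        · rw [← Finsupp.filter_apply_pos (fun a => a ∈ A m) c ham, ← hc₁, hc₁0] at ha
          exact absurd rfl ha
    have hidx : ∀ a, c a ≠ 0 → ∃ m, a ∈ A m := fun a ha =>
      Set.mem_iUnion.1 (hcA (Finsupp.mem_support_iff.2 ha))
    choose! i hi using hidx
    exact main (c.support.sup i + 1) fun a ha =>
      ⟨i a, Nat.lt_succ_of_le (Finset.le_sup (Finsupp.mem_support_iff.2 ha)), hi a ha⟩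
  · intro S hS hAS
    have hle : ∀ m, Fil m ≤ S := by
      intro m
      induction m with
      | zero => rw [hzero]; exact bot_le
      | succ m ih =>
        rw [← hDsup m]
        refine sup_le (sup_le ih ?_) ?_
        · rintro _ ⟨v, hv, rfl⟩
          exact hS v (ih hv)
        · rw [← hspan m, Submodule.span_le]
          exact (Set.subset_iUnion A m).trans hAS
    rw [eq_top_iff]
    intro v _
    obtain ⟨m, hm⟩ := hexh v
    exact hle m hm

/-- If a ring acts on `V` as the polynomial ring in `τ`, a set `A` that is linearly independent
modulo the image of `τ` and generates `V` under `τ` is a basis of `V` over that ring. -/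
theorem exists_basis_of_polynomial {H : Type*} [Semiring H] [Module H V] {τ : Module.End k V}
    (hinj : Function.Injective τ) {A : Set V}
    (hind : ∀ c ∈ Finsupp.supported k k A, ∀ v, Finsupp.linearCombination k id c = τ v → c = 0)
    (hgen : ∀ S : Submodule k V, (∀ v ∈ S, τ v ∈ S) → A ⊆ S → S = ⊤)
    (φ : Polynomial k ≃+* H) (hφ : ∀ P v, φ P • v = Polynomial.aeval τ P v) :
    ∃ b : Module.Basis A H V, ∀ a, b a = a := by
  let : Module (Polynomial k) V := Module.compHom V (φ : Polynomial k →+* H)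
  have hsmul : ∀ (P : Polynomial k) (v : V), P • v = Polynomial.aeval τ P v := hφ
  have hli : LinearIndependent (Polynomial k) (Subtype.val : A → V) := by
    refine linearIndependent_subtype_iff.2 (linearIndepOn_iff'.2 fun s P hs hsum => ?_)
    refine eq_zero_of_sum_aeval_eq_zero hinj hind s hs P ?_
    rw [← hsum]
    exact Finset.sum_congr rfl fun a _ => (hsmul _ _).symm
  have hspan : ⊤ ≤ Submodule.span (Polynomial k) (Set.range (Subtype.val : A → V)) := by
    rw [Subtype.range_coe]
    let S : Submodule k V :=
      { carrier := Submodule.span (Polynomial k) A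
        zero_mem' := zero_mem _
        add_mem' := add_mem
        smul_mem' := fun c f hf => by
          have h : (Polynomial.C c : Polynomial k) • f = c • f := by
            rw [hsmul, Polynomial.aeval_C]
            rfl
          rw [← h]
          exact (Submodule.span (Polynomial k) A).smul_mem _ hf }
    have hS : S = ⊤ := hgen S (fun f hf => by
      have h : (Polynomial.X : Polynomial k) • f = τ f := by rw [hsmul, Polynomial.aeval_X]
      rw [← h]
      exact (Submodule.span (Polynomial k) A).smul_mem _ hf) Submodule.subset_span
    intro f _
    have hf : f ∈ S := hS ▸ Submodule.mem_top
    exact hf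
  exact ⟨(Module.Basis.mk hli hspan).mapCoeffs φ fun P v => (hφ P v).trans (hsmul P v).symm,
    fun a => by rw [Module.Basis.mapCoeffs_apply, Module.Basis.mk_apply]⟩

end Filtered

/-! ### Symmetric powers -/

section SymmetricPowers

variable {k : Type*} [Field k]

/-- The exponent of the monomial `X^l Y^(d-l)`. -/
noncomputable def symExponent (d l : ℕ) : Fin 2 →₀ ℕ :=
  Finsupp.single 0 l + Finsupp.single 1 (d - l)

theorem symExponent_injective (d : ℕ) : Function.Injective (symExponent d) := fun l l' h => by
  have := DFunLike.congr_fun h 0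
  simpa [symExponent] using this

variable (k) in
/-- The monomial `X^l Y^(d-l)`, for `l ≤ d`. -/
noncomputable def symMonomial (d : ℕ) (l : Fin (d + 1)) : SymPow k d :=
  ⟨MvPolynomial.X 0 ^ (l : ℕ) * MvPolynomial.X 1 ^ (d - l), by
    have h := (MvPolynomial.isHomogeneous_X_pow (R := k) (0 : Fin 2) (l : ℕ)).mul
      (MvPolynomial.isHomogeneous_X_pow (R := k) (1 : Fin 2) (d - l))
    rwa [Nat.add_sub_cancel' (Nat.le_of_lt_succ l.2)] at h⟩

theorem symMonomial_eq_monomial (d : ℕ) (l : Fin (d + 1)) :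
    (symMonomial k d l).1 = MvPolynomial.monomial (symExponent d l) 1 := by
  change MvPolynomial.X 0 ^ (l : ℕ) * MvPolynomial.X 1 ^ (d - l) = _
  rw [MvPolynomial.X_pow_eq_monomial, MvPolynomial.X_pow_eq_monomial,
    MvPolynomial.monomial_mul, one_mul, symExponent]

variable (k) in
/-- The basis of `Sym^d k²` that consists of the monomials `X^l Y^(d-l)`. -/
noncomputable def symBasis (d : ℕ) : Module.Basis (Fin (d + 1)) k (SymPow k d) :=
  Module.Basis.ofEquivFun
    { toFun f l := MvPolynomial.coeff (symExponent d l) f.1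
      map_add' _ _ := by ext; simp
      map_smul' _ _ := by ext; simp
      invFun c := ∑ l, c l • symMonomial k d l
      left_inv f := by
        classical
        apply Subtype.ext
        ext s
        simp only [Submodule.coe_sum, Submodule.coe_smul, symMonomial_eq_monomial,
          MvPolynomial.coeff_sum, MvPolynomial.coeff_smul, MvPolynomial.coeff_monomial]
        by_cases hs : s.degree = d
        · have hs' : s = symExponent d (s 0) := by
            rw [Finsupp.degree_eq_sum, Fin.sum_univ_two] at hs
            ext i
            fin_cases i <;> simp [symExponent]
            omega
          have hlt : s 0 < d + 1 := by
            rw [Finsupp.degree_eq_sum, Fin.sum_univ_two] at hs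
            omega
          rw [Finset.sum_eq_single ⟨s 0, hlt⟩]
          · simp [← hs']
          · intro l _ hl
            have : symExponent d l ≠ s := fun h => hl (Fin.ext
              (symExponent_injective d (h.trans hs')))
            simp [this]
          · simp
        · rw [MvPolynomial.IsHomogeneous.coeff_eq_zero f.2 hs]
          refine Finset.sum_eq_zero fun l _ => ?_
          have : symExponent d l ≠ s := by
            rintro rfl
            refine hs ?_
            have := l.2
            rw [Finsupp.degree_eq_sum, Fin.sum_univ_two]
            simp [symExponent]
            omega
          simp [this]
      right_inv c := by
        classical
        ext l
        simp only [Submodule.coe_sum, Submodule.coe_smul, symMonomial_eq_monomial,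
          MvPolynomial.coeff_sum, MvPolynomial.coeff_smul, MvPolynomial.coeff_monomial]
        rw [Finset.sum_eq_single l]
        · simp
        · intro l' _ hl
          have : symExponent d l' ≠ symExponent d l := fun h => hl (Fin.ext
            (symExponent_injective d h))
          simp [this]
        · simp }

theorem symBasis_repr (d : ℕ) (f : SymPow k d) (l : Fin (d + 1)) :
    (symBasis k d).repr f l = MvPolynomial.coeff (symExponent d l) f.1 := rfl

theorem symBasis_apply (d : ℕ) (l : Fin (d + 1)) : symBasis k d l = symMonomial k d l := by
  classical
  refine (symBasis k d).repr.injective ?_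
  ext l'
  rw [Module.Basis.repr_self, symBasis_repr, symMonomial_eq_monomial, MvPolynomial.coeff_monomial,
    Finsupp.single_apply]
  refine if_congr ?_ rfl rfl
  exact ⟨fun h => h ▸ rfl, fun h => Fin.ext (symExponent_injective d h)⟩

theorem symBasis_repr_zero (d : ℕ) (f : SymPow k d) :
    (symBasis k d).repr f 0 = MvPolynomial.eval ![0, 1] f.1 := by
  let ev : SymPow k d →ₗ[k] k :=
    (MvPolynomial.aeval (R := k) (![0, 1] : Fin 2 → k)).toLinearMap.comp (Submodule.subtype _)
  have : (symBasis k d).coord 0 = ev := by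
    refine (symBasis k d).ext fun l => ?_
    rw [Module.Basis.coord_apply, Module.Basis.repr_self, symBasis_apply]
    by_cases hl : l = 0
    · subst hl
      simp [ev, symMonomial]
    · have : (l : ℕ) ≠ 0 := fun h => hl (Fin.ext h)
      simp [ev, symMonomial, hl, this]
  exact (LinearMap.congr_fun this f).trans (by simp [ev, MvPolynomial.aeval_eq_eval])

theorem subst_mul (M N : Matrix (Fin 2) (Fin 2) k) : subst (M * N) = (subst M).comp (subst N) := by
  refine MvPolynomial.algHom_ext fun j => ?_
  simp only [subst, AlgHom.comp_apply, MvPolynomial.aeval_X, Fin.sum_univ_two,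
    Matrix.mul_apply, map_add, map_mul, MvPolynomial.aeval_C, MvPolynomial.algebraMap_eq]
  ring

theorem subst_one : subst (1 : Matrix (Fin 2) (Fin 2) k) = AlgHom.id k _ := by
  refine MvPolynomial.algHom_ext fun j => ?_
  fin_cases j <;> simp [subst]

variable (k) in
/-- The action of the monoid of all `2 × 2` matrices on `Sym^d k²`, extending `symRep`. -/
noncomputable def symMat (d : ℕ) : Matrix (Fin 2) (Fin 2) k →* Module.End k (SymPow k d) where
  toFun M := (subst M).toLinearMap.restrict (by
    intro f hf
    have h := MvPolynomial.IsHomogeneous.aeval (n := 1) hf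
      (fun j => ∑ i, MvPolynomial.C (M i j) * MvPolynomial.X i)
      (fun j => MvPolynomial.IsHomogeneous.sum _ _ _
        fun i _ => MvPolynomial.isHomogeneous_C_mul_X _ i)
    rw [one_mul] at h
    exact h)
  map_one' := by
    ext1 f
    apply Subtype.ext
    change subst (1 : Matrix (Fin 2) (Fin 2) k) f.1 = f.1
    rw [subst_one, AlgHom.id_apply]
  map_mul' M N := by
    ext1 f
    apply Subtype.ext
    change subst (M * N) f.1 = subst M (subst N f.1)
    rw [subst_mul, AlgHom.comp_apply]

theorem symMat_apply_coe (d : ℕ) (M : Matrix (Fin 2) (Fin 2) k) (f : SymPow k d) :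
    (symMat k d M f).1 = subst M f.1 := rfl

theorem symU_symBasis (d : ℕ) (l : Fin (d + 1)) :
    symU k d (symBasis k d l) = if l = 0 then symBasis k d 0 else 0 := by
  classical
  have h0 : (symBasis k d 0 : SymPow k d) =
      ⟨MvPolynomial.X 1 ^ d, MvPolynomial.isHomogeneous_X_pow _ _⟩ := by
    rw [symBasis_apply]
    exact Subtype.ext (by simp [symMonomial])
  have h1 : Finsupp.single (1 : Fin 2) d = symExponent d 0 := by simp [symExponent]
  have h2 : symU k d (symBasis k d l)
      = MvPolynomial.coeff (symExponent d 0) (symBasis k d l).1 • symBasis k d 0 := by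
    rw [h0, ← h1]; rfl
  have h3 := symBasis_repr d (symBasis k d l) 0
  rw [Module.Basis.repr_self, Finsupp.single_apply] at h3
  rw [h2]
  change MvPolynomial.coeff (symExponent d ((0 : Fin (d + 1)) : ℕ)) _ • _ = _
  rw [← h3]
  split_ifs <;> simp

/-- `U` is the action of the singular matrix `(0, 0; 0, 1)`. -/
theorem symU_eq_symMat (d : ℕ) : symU k d = symMat k d !![0, 0; 0, 1] := by
  refine (symBasis k d).ext fun l => ?_
  rw [symU_symBasis, symBasis_apply, symBasis_apply]
  refine Subtype.ext ?_
  rw [symMat_apply_coe]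
  by_cases hl : l = 0
  · subst hl
    simp [symMonomial, subst, Fin.sum_univ_two]
  · have : (l : ℕ) ≠ 0 := fun h => hl (Fin.ext h)
    simp [symMonomial, subst, hl, this]

theorem symBasis_repr_symMat_lower (d : ℕ) (x : k) (l : Fin (d + 1)) :
    (symBasis k d).repr (symMat k d !![1, 0; x, 1] (symBasis k d l)) 0 = x ^ (l : ℕ) := by
  rw [symBasis_repr_zero, symMat_apply_coe, symBasis_apply]
  simp [symMonomial, subst, Fin.sum_univ_two]

theorem symBasis_repr_symMat_upper (d : ℕ) (x : k) (l : Fin (d + 1)) :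
    (symBasis k d).repr (symMat k d !![1, x; 0, 1] (symBasis k d 0)) l
      = d.choose l * x ^ (l : ℕ) := by
  have : symMat k d !![1, x; 0, 1] (symBasis k d 0)
      = ∑ l : Fin (d + 1), ((d.choose l : k) * x ^ (l : ℕ)) • symBasis k d l := by
    refine Subtype.ext ?_
    rw [symMat_apply_coe]
    simp only [symBasis_apply, Submodule.coe_sum, Submodule.coe_smul, symMonomial, subst,
      MvPolynomial.smul_eq_C_mul]
    rw [Fin.sum_univ_eq_sum_range (fun l : ℕ => MvPolynomial.C ((d.choose l : k) * x ^ l) *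
      (MvPolynomial.X (0 : Fin 2) ^ l * MvPolynomial.X 1 ^ (d - l)))]
    simp only [map_mul, map_pow, MvPolynomial.aeval_X, Fin.sum_univ_two]
    simp only [Fin.val_zero, pow_zero, one_mul, Nat.sub_zero, Matrix.of_apply, Matrix.cons_val',
      Matrix.cons_val_zero, Matrix.cons_val_one, Matrix.cons_val_fin_one, map_one]
    rw [add_pow]
    refine Finset.sum_congr rfl fun l _ => ?_
    simp only [map_natCast]
    ring
  rw [this, Module.Basis.repr_sum_self]

end SymmetricPowers

/-! ### Weights -/

/-- A linear combination of powers with distinct exponents smaller than `#κ` that is constant on the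
finite field `κ` involves only the exponent `0`. -/
theorem coeff_eq_of_sum_pow_eq {κ k L : Type*} [Field κ] [Finite κ] [Field k] [Fintype L]
    [DecidableEq L] (ι : κ →+* k) {e : L → ℕ} (he : Function.Injective e)
    (hlt : ∀ l, e l < Nat.card κ) {l₀ : L} (hl₀ : e l₀ = 0) {a : L → k} {c : k}
    (h : ∀ x, ∑ l, a l * ι x ^ e l = c) (l : L) : a l = if l = l₀ then c else 0 := by
  classical
  have := Fintype.ofFinite κ
  let P : Polynomial k := ∑ l, Polynomial.C (a l - if l = l₀ then c else 0) * Polynomial.X ^ e l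
  have hP : P = 0 := by
    refine Polynomial.eq_zero_of_natDegree_lt_card_of_eval_eq_zero P ι.injective (fun x => ?_) ?_
    · simp only [P, Polynomial.eval_finsetSum, Polynomial.eval_mul, Polynomial.eval_C,
        Polynomial.eval_pow, Polynomial.eval_X, sub_mul, Finset.sum_sub_distrib, h x, ite_mul,
        zero_mul, Finset.sum_ite_eq', Finset.mem_univ, if_true, hl₀, pow_zero, mul_one, sub_self]
    · rw [← Nat.card_eq_fintype_card]
      refine lt_of_le_of_lt (Polynomial.natDegree_sum_le_of_forall_le (n := Nat.card κ - 1) _ _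
        fun l _ => ?_) (Nat.sub_lt Nat.card_pos one_pos)
      exact (Polynomial.natDegree_C_mul_X_pow_le _ _).trans (Nat.le_sub_one_of_lt (hlt l))
  have hc := congrArg (fun Q => Polynomial.coeff Q (e l)) hP
  simp only [P, Polynomial.finsetSum_coeff, Polynomial.coeff_C_mul, Polynomial.coeff_X_pow,
    Polynomial.coeff_zero] at hc
  rw [Finset.sum_eq_single l (fun l' _ hl' => by simp [he.ne hl'.symm]) (by simp)] at hc
  simpa [sub_eq_zero] using hc

section WeightSpace

variable (k : Type*) [Field k] {n : ℕ} (r : Fin n → ℕ)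

/-- The pure tensors in the weight. -/
noncomputable def weightTprod (x : Π i, SymPow k (r i)) : WeightSpace k r :=
  PiTensorProduct.tprod k x

/-- The action of families of matrices on the weight, one for each tensor factor. -/
noncomputable def weightMap :
    (Fin n → Matrix (Fin 2) (Fin 2) k) →* Module.End k (WeightSpace k r) :=
  PiTensorProduct.mapMonoidHom.comp <| MonoidHom.pi fun i =>
    (symMat k (r i)).comp (Pi.evalMonoidHom (fun _ => Matrix (Fin 2) (Fin 2) k) i)

/-- The basis of the weight that consists of the tensor products of monomials. -/
noncomputable def weightBasis : Module.Basis (Π i, Fin (r i + 1)) k (WeightSpace k r) :=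
  Basis.piTensorProduct fun i => symBasis k (r i)

variable {k r}

theorem weightMap_weightTprod (N : Fin n → Matrix (Fin 2) (Fin 2) k) (x : Π i, SymPow k (r i)) :
    weightMap k r N (weightTprod k r x) = weightTprod k r fun i => symMat k (r i) (N i) (x i) :=
  PiTensorProduct.map_tprod _ _

theorem weightBasis_apply (l : Π i, Fin (r i + 1)) :
    weightBasis k r l = weightTprod k r fun i => symBasis k (r i) (l i) :=
  Basis.piTensorProduct_apply _ _

theorem weightBasis_repr_weightTprod (x : Π i, SymPow k (r i)) (l : Π i, Fin (r i + 1)) :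
    (weightBasis k r).repr (weightTprod k r x) l = ∏ i, (symBasis k (r i)).repr (x i) (l i) :=
  Basis.piTensorProduct_repr_tprod_apply _ _ _

theorem weightU_eq_weightMap : weightU k r = weightMap k r fun _ => !![0, 0; 0, 1] := by
  have : (fun i => symU k (r i)) = fun i => symMat k (r i) !![0, 0; 0, 1] :=
    funext fun i => symU_eq_symMat (r i)
  rw [weightU, this]
  rfl

/-- `U_r` is the projection to the line of `Y^r`. -/
theorem weightU_apply (w : WeightSpace k r) :
    weightU k r w = (weightBasis k r).repr w 0 • weightBasis k r 0 := by
  classical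
  have : weightU k r = ((weightBasis k r).coord 0).smulRight (weightBasis k r 0) := by
    refine (weightBasis k r).ext fun l => ?_
    rw [LinearMap.smulRight_apply, Module.Basis.coord_apply,
      Module.Basis.repr_self, Finsupp.single_apply, weightU_eq_weightMap, weightBasis_apply,
      weightMap_weightTprod, weightBasis_apply]
    simp only [← symU_eq_symMat, symU_symBasis]
    split_ifs with hl
    · subst hl
      simp
    · obtain ⟨i, hi⟩ := Function.ne_iff.1 hl
      rw [zero_smul]
      exact (PiTensorProduct.tprod k).map_coord_zero i (if_neg hi)
  rw [this]
  rfl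

/-- The exponent `∑ l_i p^i` of a multi-index. -/
def weightExponent (p : ℕ) (l : Π i, Fin (r i + 1)) : ℕ := ∑ i, (l i : ℕ) * p ^ (i : ℕ)

theorem weightExponent_injective {p : ℕ} (hr : ∀ i, r i < p) :
    Function.Injective (weightExponent p : (Π i, Fin (r i + 1)) → ℕ) := by
  intro l l' h
  have hlt : ∀ (l : Π i, Fin (r i + 1)) i, (l i : ℕ) < p := fun l i =>
    (Nat.le_of_lt_succ (l i).2).trans_lt (hr i)
  have : finFunctionFinEquiv (fun i => (⟨l i, hlt l i⟩ : Fin p))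
      = finFunctionFinEquiv (fun i => (⟨l' i, hlt l' i⟩ : Fin p)) := by
    refine Fin.ext ?_
    rw [finFunctionFinEquiv_apply, finFunctionFinEquiv_apply]
    exact h
  funext i
  have h2 := congrFun (finFunctionFinEquiv.injective this) i
  exact Fin.ext (Fin.mk.inj_iff.1 h2)

theorem weightExponent_lt {p : ℕ} (hr : ∀ i, r i < p) (l : Π i, Fin (r i + 1)) :
    weightExponent p l < p ^ n := by
  have hlt : ∀ i, (l i : ℕ) < p := fun i => (Nat.le_of_lt_succ (l i).2).trans_lt (hr i)
  have := (finFunctionFinEquiv (fun i => (⟨l i, hlt i⟩ : Fin p))).2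
  rwa [finFunctionFinEquiv_apply] at this

theorem repr_weightMap_lower (p : ℕ) (x : k) (l : Π i, Fin (r i + 1)) :
    (weightBasis k r).repr (weightMap k r (fun i => !![1, 0; x ^ p ^ (i : ℕ), 1])
      (weightBasis k r l)) 0 = x ^ weightExponent p l := by
  rw [weightBasis_apply, weightMap_weightTprod, weightBasis_repr_weightTprod, weightExponent,
    ← Finset.prod_pow_eq_pow_sum]
  refine Finset.prod_congr rfl fun i _ => ?_
  rw [mul_comm, pow_mul, ← symBasis_repr_symMat_lower (r i)]
  rfl

theorem repr_weightMap_upper (p : ℕ) (x : k) (l : Π i, Fin (r i + 1)) :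
    (weightBasis k r).repr (weightMap k r (fun i => !![1, x ^ p ^ (i : ℕ); 0, 1])
      (weightBasis k r 0)) l
      = (∏ i, ((r i).choose (l i) : k)) * x ^ weightExponent p l := by
  rw [weightBasis_apply, weightMap_weightTprod, weightBasis_repr_weightTprod, weightExponent,
    ← Finset.prod_pow_eq_pow_sum, ← Finset.prod_mul_distrib]
  refine Finset.prod_congr rfl fun i _ => ?_
  rw [mul_comm (l i : ℕ), pow_mul, ← symBasis_repr_symMat_upper (r i)]
  rfl

end WeightSpace

section Weights

variable {F : Type*} [Field F] [ValuativeRel F] [TopologicalSpace F] [IsNonarchimedeanLocalField F]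
  (p : ℕ) [Fact p.Prime] [CharP 𝓀[F] p] {k : Type*} [Field k] (ι : 𝓀[F] →+* k) {n : ℕ}
  (r : Fin n → ℕ)

/-- The extension of the weight `σ_r` to the monoid of all `2 × 2` matrices over `𝒪_F`. -/
noncomputable def weightMat : Matrix (Fin 2) (Fin 2) 𝒪[F] →* Module.End k (WeightSpace k r) :=
  (weightMap k r).comp <| MonoidHom.pi fun i : Fin n =>
    (((ι.comp (iterateFrobenius 𝓀[F] p i)).comp
        (IsLocalRing.residue 𝒪[F])).mapMatrix : _ →+* Matrix (Fin 2) (Fin 2) k).toMonoidHom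

theorem weightMat_coe (g : K0 F) :
    weightMat p ι r (g : Matrix (Fin 2) (Fin 2) 𝒪[F]) = weight p ι r g := rfl

theorem weightMat_eq_weightMap (M : Matrix (Fin 2) (Fin 2) 𝒪[F]) :
    weightMat p ι r M = weightMap k r fun i =>
      M.map fun a => ι (IsLocalRing.residue 𝒪[F] a) ^ p ^ (i : ℕ) := by
  have : weightMat p ι r M = weightMap k r fun i : Fin n =>
      ((ι.comp (iterateFrobenius 𝓀[F] p i)).comp (IsLocalRing.residue 𝒪[F])).mapMatrix M := rfl
  rw [this]
  congr 1
  funext i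
  ext a b
  simp [iterateFrobenius_def]

/-- The value of the extended weight depends only on the matrix modulo the maximal ideal. -/
theorem weightMat_congr {M N : Matrix (Fin 2) (Fin 2) 𝒪[F]}
    (h : ∀ i j, IsLocalRing.residue 𝒪[F] (M i j) = IsLocalRing.residue 𝒪[F] (N i j)) :
    weightMat p ι r M = weightMat p ι r N := by
  rw [weightMat_eq_weightMap, weightMat_eq_weightMap]
  congr 1
  funext i
  ext a b
  simp [h a b]

theorem weightMat_diag : weightMat p ι r !![(0 : 𝒪[F]), 0; 0, 1] = weightU k r := by
  have hp : p ≠ 0 := (Fact.out : p.Prime).ne_zero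
  rw [weightMat_eq_weightMap, weightU_eq_weightMap]
  congr 1
  funext i
  ext a b
  fin_cases a <;> fin_cases b <;> simp [hp]

theorem weight_lower (t : 𝒪[F]) : weight p ι r (lower t) = weightMap k r
    fun i => !![1, 0; ι (IsLocalRing.residue 𝒪[F] t) ^ p ^ (i : ℕ), 1] := by
  have hp : p ≠ 0 := (Fact.out : p.Prime).ne_zero
  have h1 : ((lower t : SpecialLinearGroup (Fin 2) 𝒪[F]) : Matrix (Fin 2) (Fin 2) 𝒪[F])
    = !![1, 0; t, 1] := rfl
  rw [← weightMat_coe, weightMat_eq_weightMap, h1]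
  congr 1
  funext i
  ext a b
  fin_cases a <;> fin_cases b <;> simp [hp]

theorem weight_upper (t : 𝒪[F]) : weight p ι r (upper t) = weightMap k r
    fun i => !![1, ι (IsLocalRing.residue 𝒪[F] t) ^ p ^ (i : ℕ); 0, 1] := by
  have hp : p ≠ 0 := (Fact.out : p.Prime).ne_zero
  have h1 : ((upper t : SpecialLinearGroup (Fin 2) 𝒪[F]) : Matrix (Fin 2) (Fin 2) 𝒪[F])
    = !![1, t; 0, 1] := rfl
  rw [← weightMat_coe, weightMat_eq_weightMap, h1]
  congr 1
  funext i
  ext a b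
  fin_cases a <;> fin_cases b <;> simp [hp]

variable {p ι r} in
/-- A vector whose translates by lower unipotent matrices all have the same coordinate at `Y^r` is
a multiple of `Y^r`. -/
theorem eq_smul_of_coord_lower (hn : Nat.card 𝓀[F] = p ^ n) (hr : ∀ i, r i < p)
    {w : WeightSpace k r} {c : k}
    (h : ∀ t, (weightBasis k r).repr (weight p ι r (lower t) w) 0 = c) :
    w = c • weightBasis k r 0 := by
  classical
  refine (weightBasis k r).ext_elem fun l => ?_
  rw [coeff_eq_of_sum_pow_eq ι (weightExponent_injective hr)
    (fun l => hn ▸ weightExponent_lt hr l) (l₀ := 0) (by simp [weightExponent])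
    (a := (weightBasis k r).repr w) (c := c) ?_ l]
  · simp [Finsupp.single_apply, eq_comm]
  · intro x
    obtain ⟨t, rfl⟩ := IsLocalRing.residue_surjective x
    rw [← h t]
    conv_rhs => rw [← (weightBasis k r).sum_repr w]
    simp only [map_sum, map_smul, Finsupp.finsetSum_apply, Finsupp.smul_apply, weight_lower,
      repr_weightMap_lower, smul_eq_mul]

variable {p ι r} in
/-- A linear form that takes the same value on all translates of `Y^r` by upper unipotent matrices
is a multiple of the coordinate at `Y^r`. This uses that the binomial coefficients `r_i choose l_i`
are prime to `p`. -/
theorem eq_smul_coord_of_upper (hn : Nat.card 𝓀[F] = p ^ n) (hr : ∀ i, r i < p)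
    {μ : WeightSpace k r →ₗ[k] k} {c : k}
    (h : ∀ t, μ (weight p ι r (upper t) (weightBasis k r 0)) = c) :
    μ = c • (weightBasis k r).coord 0 := by
  classical
  have hp : p.Prime := Fact.out
  have : CharP k p := (RingHom.charP_iff ι ι.injective p).1 inferInstance
  refine (weightBasis k r).ext fun l => ?_
  have hl := coeff_eq_of_sum_pow_eq ι (weightExponent_injective hr)
    (fun l => hn ▸ weightExponent_lt hr l) (l₀ := 0) (by simp [weightExponent])
    (a := fun l => (∏ i, ((r i).choose (l i) : k)) * μ (weightBasis k r l)) (c := c) ?_ l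
  · have hne : (∏ i, ((r i).choose (l i) : k)) ≠ 0 := by
      refine Finset.prod_ne_zero_iff.2 fun i _ => ?_
      rw [Ne, CharP.cast_eq_zero_iff k p]
      intro hdvd
      have h1 := hp.dvd_factorial.1 ((hdvd.trans (by
          rw [← Nat.choose_mul_factorial_mul_factorial (Nat.le_of_lt_succ (l i).2), mul_assoc]
          exact Dvd.intro _ rfl)))
      exact absurd (hr i) (not_lt.2 h1)
    rw [LinearMap.smul_apply, Module.Basis.coord_apply, Module.Basis.repr_self,
      Finsupp.single_apply]
    by_cases h0 : l = 0
    · subst h0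
      simpa using hl
    · simpa [h0, hne] using hl
  · intro x
    obtain ⟨t, rfl⟩ := IsLocalRing.residue_surjective x
    rw [← h t]
    conv_rhs => rw [← (weightBasis k r).sum_repr (weight p ι r (upper t) (weightBasis k r 0))]
    rw [map_sum]
    refine Finset.sum_congr rfl fun l _ => ?_
    rw [map_smul, weight_upper, repr_weightMap_upper, smul_eq_mul]
    ring

end Weights

/-! ### Balls in `SL₂(F)` and the Cartan decomposition -/

section Geometry

variable {F : Type*} [Field F] [ValuativeRel F] {ϖ : 𝒪[F]} (hϖ : Irreducible ϖ)

theorem uniformizer_ne_zero (hϖ : Irreducible ϖ) : (ϖ : F) ≠ 0 :=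
  fun h => hϖ.ne_zero (Subtype.ext h)

variable (ϖ) in
/-- The set of `g ∈ SL₂(F)` such that `ϖ^m g` has integral entries. In terms of the Bruhat-Tits
tree, these are the elements that move the central vertex by at most `2 m`. -/
def InBall (m : ℕ) (g : GS F) : Prop := ∀ i j, (ϖ : F) ^ m * g.1 i j ∈ 𝒪[F]

theorem incl_apply (a : K0 F) (i j : Fin 2) : (incl F a).1 i j = (a.1 i j : F) := rfl

theorem incl_injective : Function.Injective (incl F) := by
  intro a b h
  refine Matrix.SpecialLinearGroup.ext _ _ fun i j => Subtype.ext ?_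
  exact congrFun (congrFun (congrArg Subtype.val h) i) j

theorem exists_incl_mul_out (x : GS F) :
    ∃ a, incl F a * (Quotient.mk (QuotientGroup.rightRel (incl F).range) x).out = x := by
  have h : QuotientGroup.rightRel (incl F).range
      (Quotient.mk (QuotientGroup.rightRel (incl F).range) x).out x := Quotient.mk_out x
  obtain ⟨a, ha⟩ := MonoidHom.mem_range.1 (QuotientGroup.rightRel_apply.1 h)
  exact ⟨a, by rw [ha, inv_mul_cancel_right]⟩

theorem inBall_zero_iff {g : GS F} : InBall ϖ 0 g ↔ ∃ a, incl F a = g := by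
  constructor
  · intro h
    simp only [InBall, pow_zero, one_mul] at h
    have hdet : (Matrix.of fun i j => (⟨g.1 i j, h i j⟩ : 𝒪[F])).det = 1 := by
      refine Subtype.ext ?_
      have := g.2
      rw [Matrix.det_fin_two] at this ⊢
      simpa using this
    exact ⟨⟨_, hdet⟩, Matrix.SpecialLinearGroup.ext _ _ fun i j => rfl⟩
  · rintro ⟨a, rfl⟩ i j
    rw [pow_zero, one_mul, incl_apply]
    exact (a.1 i j).2

theorem inBall_incl (a : K0 F) : InBall ϖ 0 (incl F a) := inBall_zero_iff.2 ⟨a, rfl⟩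

theorem InBall.mono {m l : ℕ} (hml : m ≤ l) {g : GS F} (h : InBall ϖ m g) : InBall ϖ l g := by
  intro i j
  obtain ⟨d, rfl⟩ := Nat.exists_eq_add_of_le hml
  rw [pow_add, mul_comm (_ ^ m), mul_assoc]
  exact mul_mem (pow_mem ϖ.2 d) (h i j)

theorem InBall.mul {m l : ℕ} {g g' : GS F} (h : InBall ϖ m g) (h' : InBall ϖ l g') :
    InBall ϖ (m + l) (g * g') := by
  intro i j
  have : (ϖ : F) ^ (m + l) * (g * g').1 i j =
      ((ϖ : F) ^ m * g.1 i 0) * ((ϖ : F) ^ l * g'.1 0 j)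
        + ((ϖ : F) ^ m * g.1 i 1) * ((ϖ : F) ^ l * g'.1 1 j) := by
    rw [Matrix.SpecialLinearGroup.coe_mul, Matrix.mul_apply, Fin.sum_univ_two]
    ring
  rw [this]
  exact add_mem (mul_mem (h _ _) (h' _ _)) (mul_mem (h _ _) (h' _ _))

theorem InBall.inv {m : ℕ} {g : GS F} (h : InBall ϖ m g) : InBall ϖ m g⁻¹ := by
  intro i j
  rw [Matrix.SpecialLinearGroup.coe_inv, Matrix.adjugate_fin_two]
  fin_cases i <;> fin_cases j
  · simpa using h 1 1
  · simpa using h 0 1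
  · simpa using h 1 0
  · simpa using h 0 0

theorem inBall_inv_iff {m : ℕ} {g : GS F} : InBall ϖ m g⁻¹ ↔ InBall ϖ m g :=
  ⟨fun h => by simpa using h.inv, InBall.inv⟩

theorem inBall_incl_mul_iff {m : ℕ} (a : K0 F) {g : GS F} :
    InBall ϖ m (incl F a * g) ↔ InBall ϖ m g := by
  constructor
  · intro h
    have := (inBall_incl (ϖ := ϖ) a⁻¹).mul h
    rwa [zero_add, map_inv, inv_mul_cancel_left] at this
  · intro h
    simpa using (inBall_incl (ϖ := ϖ) a).mul h

theorem inBall_mul_incl_iff {m : ℕ} (a : K0 F) {g : GS F} :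
    InBall ϖ m (g * incl F a) ↔ InBall ϖ m g := by
  rw [← inBall_inv_iff, _root_.mul_inv_rev, ← map_inv, inBall_incl_mul_iff, inBall_inv_iff]

theorem inBall_out_iff {m : ℕ} (y : GS F) :
    InBall ϖ m (y : GS F ⧸ (incl F).range).out ↔ InBall ϖ m y := by
  have h : (((y : GS F ⧸ (incl F).range).out : GS F) : GS F ⧸ (incl F).range) = y :=
    QuotientGroup.out_eq' _
  obtain ⟨a, ha⟩ := MonoidHom.mem_range.1 (QuotientGroup.eq.1 h)
  rw [← inBall_mul_incl_iff a, ha, mul_inv_cancel_left]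

variable (ϖ) in
/-- The elements of exact level `m`: those `g` for which `m` is minimal with `ϖ^m g` integral. -/
def OnSphere (m : ℕ) (g : GS F) : Prop := InBall ϖ m g ∧ ∀ j < m, ¬ InBall ϖ j g

theorem onSphere_incl_mul_iff {m : ℕ} (a : K0 F) {g : GS F} :
    OnSphere ϖ m (incl F a * g) ↔ OnSphere ϖ m g := by
  simp only [OnSphere, inBall_incl_mul_iff]

theorem onSphere_mul_incl_iff {m : ℕ} (a : K0 F) {g : GS F} :
    OnSphere ϖ m (g * incl F a) ↔ OnSphere ϖ m g := by
  simp only [OnSphere, inBall_mul_incl_iff]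

theorem onSphere_inv_iff {m : ℕ} {g : GS F} : OnSphere ϖ m g⁻¹ ↔ OnSphere ϖ m g := by
  simp only [OnSphere, inBall_inv_iff]

/-- If `ϖ^m g` is integral and has an entry that is a unit, then `g` has level `m`. -/
theorem onSphere_of_isUnit (hϖ : Irreducible ϖ) {m : ℕ} {g : GS F} (h : InBall ϖ m g) {i j : Fin 2}
    {u : 𝒪[F]} (hu : IsUnit u) (hg : (ϖ : F) ^ m * g.1 i j = u) : OnSphere ϖ m g := by
  refine ⟨h, fun l hl hb => hϖ.not_isUnit ?_⟩
  obtain ⟨d, rfl⟩ := Nat.exists_eq_add_of_lt hl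
  have h1 : u = ϖ * (ϖ ^ d * ⟨_, hb i j⟩) := by
    refine Subtype.ext ?_
    rw [← hg]
    push_cast
    ring
  rw [h1] at hu
  exact isUnit_of_mul_isUnit_left hu

theorem alpha0_pow_val (m : ℕ) :
    (alpha0 hϖ ^ m).1 = !![((ϖ : F) ^ m)⁻¹, 0; 0, (ϖ : F) ^ m] := by
  induction m with
  | zero => ext i j; fin_cases i <;> fin_cases j <;> simp
  | succ m ih =>
    have h1 : (alpha0 hϖ).1 = !![(ϖ : F)⁻¹, 0; 0, (ϖ : F)] := rfl
    rw [pow_succ, Matrix.SpecialLinearGroup.coe_mul, ih, h1, Matrix.mul_fin_two]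
    simp [pow_succ, mul_comm]

theorem alpha0_pow_inv_val (m : ℕ) :
    (alpha0 hϖ ^ m)⁻¹.1 = !![(ϖ : F) ^ m, 0; 0, ((ϖ : F) ^ m)⁻¹] := by
  rw [Matrix.SpecialLinearGroup.coe_inv, alpha0_pow_val, Matrix.adjugate_fin_two]
  simp

theorem onSphere_alpha0_pow (m : ℕ) : OnSphere ϖ m (alpha0 hϖ ^ m) := by
  have h0 := uniformizer_ne_zero hϖ
  refine onSphere_of_isUnit hϖ (i := 0) (j := 0) (fun i j => ?_) isUnit_one ?_
  · rw [alpha0_pow_val]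
    fin_cases i <;> fin_cases j
    · simp [h0, one_mem]
    · simp [zero_mem]
    · simp [zero_mem]
    · simpa using mul_mem (pow_mem ϖ.2 m) (pow_mem ϖ.2 m)
  · rw [alpha0_pow_val]
    simp [h0]

theorem onSphere_alpha0_pow_inv (m : ℕ) : OnSphere ϖ m (alpha0 hϖ ^ m)⁻¹ :=
  onSphere_inv_iff.2 (onSphere_alpha0_pow hϖ m)

theorem upper_val {R : Type*} [CommRing R] (x : R) : (upper x).1 = !![1, x; 0, 1] := rfl

theorem lower_val {R : Type*} [CommRing R] (x : R) : (lower x).1 = !![1, 0; x, 1] := rfl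

theorem incl_upper (t : 𝒪[F]) : incl F (upper t) = upper (t : F) := by
  refine Matrix.SpecialLinearGroup.ext _ _ fun i j => ?_
  rw [incl_apply]
  fin_cases i <;> fin_cases j <;> simp [upper]

theorem incl_lower (t : 𝒪[F]) : incl F (lower t) = lower (t : F) := by
  refine Matrix.SpecialLinearGroup.ext _ _ fun i j => ?_
  rw [incl_apply]
  fin_cases i <;> fin_cases j <;> simp [lower]

theorem w0_mul_alpha0_pow_inv (m : ℕ) :
    incl F w0 * (alpha0 hϖ ^ m)⁻¹ = alpha0 hϖ ^ m * incl F w0 := by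
  have h : (incl F w0).1 = !![0, -1; 1, 0] := by
    ext i j
    rw [incl_apply]
    fin_cases i <;> fin_cases j <;> simp [w0]
  refine Matrix.SpecialLinearGroup.ext _ _ fun i j => ?_
  rw [Matrix.SpecialLinearGroup.coe_mul, Matrix.SpecialLinearGroup.coe_mul,
    alpha0_pow_val, alpha0_pow_inv_val,
    h, Matrix.mul_fin_two, Matrix.mul_fin_two]
  simp

/-- Uniqueness of the parent: the vertex `α₀^(-(m+1))` at level `m + 1` has a unique neighbour of
level at most `m`. -/
theorem eq_of_inBall_of_inBall_mul_inv {m : ℕ} {z : GS F} (hz : InBall ϖ m z)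
    (h : InBall ϖ 1 ((alpha0 hϖ ^ (m + 1))⁻¹ * z⁻¹)) :
    ∃ a, z = incl F a * (alpha0 hϖ ^ m)⁻¹ := by
  have h0 := uniformizer_ne_zero hϖ
  have key : InBall ϖ 0 (z * alpha0 hϖ ^ m) := by
    have h1 : ∀ j, (ϖ : F) ^ 1 * ((alpha0 hϖ ^ (m + 1))⁻¹ * z⁻¹).1 1 j
        = ((ϖ : F) ^ m)⁻¹ * !![z.1 1 1, -z.1 0 1; -z.1 1 0, z.1 0 0] 1 j := by
      intro j
      rw [Matrix.SpecialLinearGroup.coe_mul, alpha0_pow_inv_val, Matrix.SpecialLinearGroup.coe_inv,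
        Matrix.adjugate_fin_two, Matrix.mul_apply, Fin.sum_univ_two]
      simp [pow_succ]
      field_simp
    intro i j
    rw [Matrix.SpecialLinearGroup.coe_mul, alpha0_pow_val, Matrix.mul_apply, Fin.sum_univ_two]
    fin_cases j
    · fin_cases i
      · have := h 1 1
        rw [h1] at this
        simpa [mul_comm] using this
      · have := h 1 0
        rw [h1] at this
        simpa [mul_comm] using this
    · have := hz i 1
      simpa [mul_comm] using this
  obtain ⟨a, ha⟩ := inBall_zero_iff.1 key
  exact ⟨a, by rw [ha, mul_inv_cancel_right]⟩

theorem alpha0_pow_inv_mul_upper (m : ℕ) (t : 𝒪[F]) :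
    (alpha0 hϖ ^ m)⁻¹ * incl F (upper t)
      = incl F (upper (ϖ ^ m * ϖ ^ m * t)) * (alpha0 hϖ ^ m)⁻¹ := by
  have h0 := uniformizer_ne_zero hϖ
  refine Matrix.SpecialLinearGroup.ext _ _ fun i j => ?_
  rw [Matrix.SpecialLinearGroup.coe_mul, Matrix.SpecialLinearGroup.coe_mul,
    alpha0_pow_inv_val, incl_upper,
    incl_upper, upper_val, upper_val, Matrix.mul_fin_two, Matrix.mul_fin_two]
  fin_cases i <;> fin_cases j <;> simp
  field_simp

theorem alpha0_pow_inv_mul_lower (m : ℕ) (t : 𝒪[F]) :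
    (alpha0 hϖ ^ m)⁻¹ * incl F (lower (ϖ ^ m * ϖ ^ m * t))
      = incl F (lower t) * (alpha0 hϖ ^ m)⁻¹ := by
  have h0 := uniformizer_ne_zero hϖ
  refine Matrix.SpecialLinearGroup.ext _ _ fun i j => ?_
  rw [Matrix.SpecialLinearGroup.coe_mul, Matrix.SpecialLinearGroup.coe_mul,
    alpha0_pow_inv_val, incl_lower,
    incl_lower, lower_val, lower_val, Matrix.mul_fin_two, Matrix.mul_fin_two]
  fin_cases i <;> fin_cases j <;> simp
  field_simp

theorem exists_lt_succ_inBall_iff {m : ℕ} {x : GS F} :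
    (∃ j < m + 1, InBall ϖ j x) ↔ InBall ϖ m x :=
  ⟨fun ⟨_, hj, h⟩ => h.mono (Nat.le_of_lt_succ hj), fun h => ⟨m, Nat.lt_succ_self m, h⟩⟩

theorem onSphere_child (m : ℕ) (a b : K0 F) :
    OnSphere ϖ m ((alpha0 hϖ ^ m)⁻¹ * incl F a * incl F b) := by
  rw [onSphere_mul_incl_iff, onSphere_mul_incl_iff]
  exact onSphere_alpha0_pow_inv hϖ m

theorem OnSphere.not_exists_inBall {m : ℕ} {x : GS F} (h : OnSphere ϖ m x) :
    ¬ ∃ j < m, InBall ϖ j x := fun ⟨j, hj, hb⟩ => h.2 j hj hb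

variable [TopologicalSpace F] [IsNonarchimedeanLocalField F]

theorem isUnit_or_exists_eq_mul (hϖ : Irreducible ϖ) (x : 𝒪[F]) : IsUnit x ∨ ∃ y, x = ϖ * y := by
  rw [or_iff_not_imp_left]
  intro hx
  have h : x ∈ IsLocalRing.maximalIdeal 𝒪[F] := (IsLocalRing.mem_maximalIdeal x).2 hx
  rw [hϖ.maximalIdeal_eq, Ideal.mem_span_singleton] at h
  exact h

theorem exists_pow_mul_mem (hϖ : Irreducible ϖ) (x : F) : ∃ m : ℕ, (ϖ : F) ^ m * x ∈ 𝒪[F] := by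
  obtain ⟨⟨a, b⟩, hab⟩ := IsLocalization.surj (nonZeroDivisors 𝒪[F]) x
  obtain ⟨m, u, hu⟩ := IsDiscreteValuationRing.associated_pow_irreducible
    (nonZeroDivisors.ne_zero b.2) hϖ
  refine ⟨m, ?_⟩
  have h1 : (ϖ : F) ^ m * x = ((a * u : 𝒪[F]) : F) := by
    have h2 : ((b : 𝒪[F]) : F) * ((u : 𝒪[F]) : F) = (ϖ : F) ^ m := by
      exact_mod_cast congrArg Subtype.val hu
    have h3 : x * ((b : 𝒪[F]) : F) = (a : F) := hab
    push_cast
    rw [← h2, ← h3]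
    ring
  rw [h1]
  exact Subtype.property _

theorem exists_inBall (hϖ : Irreducible ϖ) (g : GS F) : ∃ m, InBall ϖ m g := by
  choose N hN using fun i j => exists_pow_mul_mem hϖ (g.1 i j)
  refine ⟨N 0 0 + N 0 1 + N 1 0 + N 1 1, fun i j => ?_⟩
  have hle : N i j ≤ N 0 0 + N 0 1 + N 1 0 + N 1 1 := by
    fin_cases i <;> fin_cases j <;> simp <;> omega
  obtain ⟨d, hd⟩ := Nat.exists_eq_add_of_le hle
  rw [hd, pow_add, mul_comm (_ ^ N i j), mul_assoc]
  exact mul_mem (pow_mem ϖ.2 d) (hN i j)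

/-- Representatives of the cosets `K₀ g` of level `m`. They refine the Cartan decomposition by the
two `I(1)`-orbits on each sphere of the tree. -/
theorem OnSphere.exists_eq (hϖ : Irreducible ϖ) {m : ℕ} {g : GS F} (hg : OnSphere ϖ m g) :
    (∃ (a : K0 F) (t : 𝒪[F]), g = incl F a * alpha0 hϖ ^ m * incl F (upper t)) ∨
    ∃ (a : K0 F) (c : 𝒪[F]), g = incl F a * (alpha0 hϖ ^ m)⁻¹ * incl F (lower (ϖ * c)) := by
  have h0 := pow_ne_zero m (uniformizer_ne_zero hϖ)
  obtain ⟨M, hM⟩ : ∃ M : Fin 2 → Fin 2 → 𝒪[F], ∀ i j, (M i j : F) = (ϖ : F) ^ m * g.1 i j :=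
    ⟨fun i j => ⟨_, hg.1 i j⟩, fun i j => rfl⟩
  have hg' : ∀ i j, g.1 i j = (M i j : F) / (ϖ : F) ^ m := fun i j => by
    rw [hM, mul_div_cancel_left₀ _ h0]
  have hdetF : (M 0 0 : F) * M 1 1 - M 0 1 * M 1 0 = (ϖ : F) ^ m * (ϖ : F) ^ m := by
    have := g.2
    rw [Matrix.det_fin_two] at this
    simp only [hM]
    linear_combination (ϖ : F) ^ m * (ϖ : F) ^ m * this
  have key : ∀ (a : Matrix (Fin 2) (Fin 2) 𝒪[F]) (ha : a.det = 1),
      (∀ t : 𝒪[F], (M 0 0 = a 0 0 ∧ (M 0 1 : F) = a 0 0 * t + a 0 1 * (ϖ ^ m * ϖ ^ m) ∧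
        M 1 0 = a 1 0 ∧ (M 1 1 : F) = a 1 0 * t + a 1 1 * (ϖ ^ m * ϖ ^ m)) →
        g = incl F ⟨a, ha⟩ * alpha0 hϖ ^ m * incl F (upper t)) ∧
      (∀ t : 𝒪[F], (M 0 1 = a 0 1 ∧ (M 0 0 : F) = a 0 0 * (ϖ ^ m * ϖ ^ m) + a 0 1 * t ∧
        M 1 1 = a 1 1 ∧ (M 1 0 : F) = a 1 0 * (ϖ ^ m * ϖ ^ m) + a 1 1 * t) →
        g = incl F ⟨a, ha⟩ * (alpha0 hϖ ^ m)⁻¹ * incl F (lower t)) := by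
    intro a ha
    have haval : (incl F ⟨a, ha⟩).1 = !![(a 0 0 : F), a 0 1; a 1 0, a 1 1] := by
      ext i j
      refine (incl_apply _ i j).trans ?_
      fin_cases i <;> fin_cases j <;> rfl
    constructor
    · rintro t ⟨h1, h2, h3, h4⟩
      refine Matrix.SpecialLinearGroup.ext _ _ fun i j => ?_
      rw [Matrix.SpecialLinearGroup.coe_mul, Matrix.SpecialLinearGroup.coe_mul,
        alpha0_pow_val, incl_upper,
        upper_val, haval, hg']
      fin_cases i <;> fin_cases j
      · simp [Matrix.mul_apply, Fin.sum_univ_two, h1, div_eq_mul_inv]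
      · simp [Matrix.mul_apply, Fin.sum_univ_two, h2]
        field_simp
      · simp [Matrix.mul_apply, Fin.sum_univ_two, h3, div_eq_mul_inv]
      · simp [Matrix.mul_apply, Fin.sum_univ_two, h4]
        field_simp
    · rintro t ⟨h1, h2, h3, h4⟩
      refine Matrix.SpecialLinearGroup.ext _ _ fun i j => ?_
      rw [Matrix.SpecialLinearGroup.coe_mul, Matrix.SpecialLinearGroup.coe_mul,
        alpha0_pow_inv_val, incl_lower,
        lower_val, haval, hg']
      fin_cases i <;> fin_cases j
      · simp [Matrix.mul_apply, Fin.sum_univ_two, h2]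
        field_simp
      · simp [Matrix.mul_apply, Fin.sum_univ_two, h1, div_eq_mul_inv]
      · simp [Matrix.mul_apply, Fin.sum_univ_two, h4]
        field_simp
      · simp [Matrix.mul_apply, Fin.sum_univ_two, h3, div_eq_mul_inv]
  rcases isUnit_or_exists_eq_mul hϖ (M 0 0) with ⟨u, hu⟩ | ⟨c₀, hc₀⟩
  · have huv : (M 0 0 : F) * ((u⁻¹ : 𝒪[F]ˣ) : 𝒪[F]) = 1 := by
      rw [← hu]; exact_mod_cast congrArg Subtype.val u.mul_inv
    refine Or.inl ⟨⟨!![M 0 0, 0; M 1 0, (u⁻¹ : 𝒪[F]ˣ)], ?_⟩, (u⁻¹ : 𝒪[F]ˣ) * M 0 1,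
      (key _ _).1 _ ⟨rfl, ?_, rfl, ?_⟩⟩
    · rw [Matrix.det_fin_two_of, ← hu]; simp
    · push_cast
      simp only [Matrix.of_apply, Matrix.cons_val', Matrix.cons_val_zero, Matrix.cons_val_one,
        Matrix.cons_val_fin_one, ZeroMemClass.coe_zero]
      linear_combination -(M 0 1 : F) * huv
    · push_cast
      simp only [Matrix.of_apply, Matrix.cons_val', Matrix.cons_val_zero, Matrix.cons_val_one,
        Matrix.cons_val_fin_one]
      linear_combination -(M 1 1 : F) * huv + (((u⁻¹ : 𝒪[F]ˣ) : 𝒪[F]) : F) * hdetF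
  rcases isUnit_or_exists_eq_mul hϖ (M 1 0) with ⟨u, hu⟩ | ⟨c₁, hc₁⟩
  · have huv : (M 1 0 : F) * ((u⁻¹ : 𝒪[F]ˣ) : 𝒪[F]) = 1 := by
      rw [← hu]; exact_mod_cast congrArg Subtype.val u.mul_inv
    refine Or.inl ⟨⟨!![M 0 0, -(u⁻¹ : 𝒪[F]ˣ); M 1 0, 0], ?_⟩, (u⁻¹ : 𝒪[F]ˣ) * M 1 1,
      (key _ _).1 _ ⟨rfl, ?_, rfl, ?_⟩⟩
    · rw [Matrix.det_fin_two_of, ← hu]; simp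
    · push_cast
      simp only [Matrix.of_apply, Matrix.cons_val', Matrix.cons_val_zero, Matrix.cons_val_one,
        Matrix.cons_val_fin_one, NegMemClass.coe_neg]
      linear_combination -(M 0 1 : F) * huv - (((u⁻¹ : 𝒪[F]ˣ) : 𝒪[F]) : F) * hdetF
    · push_cast
      simp only [Matrix.of_apply, Matrix.cons_val', Matrix.cons_val_zero, Matrix.cons_val_one,
        Matrix.cons_val_fin_one, ZeroMemClass.coe_zero]
      linear_combination -(M 1 1 : F) * huv
  rcases isUnit_or_exists_eq_mul hϖ (M 1 1) with ⟨u, hu⟩ | ⟨c₂, hc₂⟩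
  · have huv : (M 1 1 : F) * ((u⁻¹ : 𝒪[F]ˣ) : 𝒪[F]) = 1 := by
      rw [← hu]; exact_mod_cast congrArg Subtype.val u.mul_inv
    have hc₁' : (M 1 0 : F) = ϖ * c₁ := congrArg Subtype.val hc₁
    refine Or.inr ⟨⟨!![(u⁻¹ : 𝒪[F]ˣ), M 0 1; 0, M 1 1], ?_⟩, (u⁻¹ : 𝒪[F]ˣ) * c₁,
      (key _ _).2 _ ⟨rfl, ?_, rfl, ?_⟩⟩
    · rw [Matrix.det_fin_two_of, ← hu]; simp
    · push_cast
      simp only [Matrix.of_apply, Matrix.cons_val', Matrix.cons_val_zero, Matrix.cons_val_one,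
        Matrix.cons_val_fin_one]
      linear_combination -(M 0 0 : F) * huv + (((u⁻¹ : 𝒪[F]ˣ) : 𝒪[F]) : F) * hdetF
        + (M 0 1 : F) * (((u⁻¹ : 𝒪[F]ˣ) : 𝒪[F]) : F) * hc₁'
    · push_cast
      simp only [Matrix.of_apply, Matrix.cons_val', Matrix.cons_val_zero, Matrix.cons_val_one,
        Matrix.cons_val_fin_one, ZeroMemClass.coe_zero]
      linear_combination -(ϖ : F) * c₁ * huv + hc₁'
  rcases isUnit_or_exists_eq_mul hϖ (M 0 1) with ⟨u, hu⟩ | ⟨c₃, hc₃⟩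
  · have huv : (M 0 1 : F) * ((u⁻¹ : 𝒪[F]ˣ) : 𝒪[F]) = 1 := by
      rw [← hu]; exact_mod_cast congrArg Subtype.val u.mul_inv
    have hc₀' : (M 0 0 : F) = ϖ * c₀ := congrArg Subtype.val hc₀
    refine Or.inr ⟨⟨!![0, M 0 1; -(u⁻¹ : 𝒪[F]ˣ), M 1 1], ?_⟩, (u⁻¹ : 𝒪[F]ˣ) * c₀,
      (key _ _).2 _ ⟨rfl, ?_, rfl, ?_⟩⟩
    · rw [Matrix.det_fin_two_of, ← hu]; simp
    · push_cast
      simp only [Matrix.of_apply, Matrix.cons_val', Matrix.cons_val_zero, Matrix.cons_val_one,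
        Matrix.cons_val_fin_one, ZeroMemClass.coe_zero]
      linear_combination -(ϖ : F) * c₀ * huv + hc₀'
    · push_cast
      simp only [Matrix.of_apply, Matrix.cons_val', Matrix.cons_val_zero, Matrix.cons_val_one,
        Matrix.cons_val_fin_one, NegMemClass.coe_neg]
      linear_combination -(M 1 0 : F) * huv - (((u⁻¹ : 𝒪[F]ˣ) : 𝒪[F]) : F) * hdetF
        + (M 1 1 : F) * (((u⁻¹ : 𝒪[F]ˣ) : 𝒪[F]) : F) * hc₀'
  -- No entry of `ϖ^m g` is a unit: this contradicts the minimality of `m`, or `det g = 1`.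
  exfalso
  have hdiv : ∀ i j, ∃ c : 𝒪[F], (ϖ : F) ^ m * g.1 i j = ϖ * c := by
    intro i j
    rw [← hM]
    fin_cases i <;> fin_cases j
    · exact ⟨c₀, congrArg Subtype.val hc₀⟩
    · exact ⟨c₃, congrArg Subtype.val hc₃⟩
    · exact ⟨c₁, congrArg Subtype.val hc₁⟩
    · exact ⟨c₂, congrArg Subtype.val hc₂⟩
  rcases m with _ | m
  · have h1 : ϖ * (ϖ * (c₀ * c₂ - c₃ * c₁)) = 1 := by
      refine Subtype.ext ?_
      rw [hc₀, hc₁, hc₂, hc₃] at hdetF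
      push_cast at hdetF ⊢
      linear_combination hdetF
    exact hϖ.not_isUnit (IsUnit.of_mul_eq_one _ h1)
  · refine hg.2 m (Nat.lt_succ_self m) fun i j => ?_
    obtain ⟨c, hc⟩ := hdiv i j
    have : (ϖ : F) ^ m * g.1 i j = c := by
      refine mul_left_cancel₀ (uniformizer_ne_zero hϖ) ?_
      rw [← hc]; ring
    rw [this]
    exact c.2

/-- The Cartan decomposition. -/
theorem OnSphere.exists_cartan (hϖ : Irreducible ϖ) {m : ℕ} {g : GS F} (hg : OnSphere ϖ m g) :
    ∃ a b : K0 F, g = incl F a * (alpha0 hϖ ^ m)⁻¹ * incl F b := by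
  rcases hg.exists_eq hϖ with ⟨a, t, rfl⟩ | ⟨a, c, rfl⟩
  · refine ⟨a * w0, w0⁻¹ * upper t, ?_⟩
    rw [map_mul, map_mul, map_inv, mul_assoc (incl F a) (incl F w0), w0_mul_alpha0_pow_inv]
    group
  · exact ⟨a, _, rfl⟩

/-- Elements `g` of level at most `m` are determined up to left multiplication by `K₀` by
the reduction of `ϖ^m g` modulo `ϖ^(2m)`. -/
theorem finite_quotient_ball (hϖ : Irreducible ϖ) (m : ℕ) :
    (Quotient.mk (QuotientGroup.rightRel (incl F).range) '' {g | InBall ϖ m g}).Finite := by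
  let J : Ideal 𝒪[F] := 𝓂[F] ^ (m + m)
  have : Finite (𝒪[F] ⧸ J) :=
    have : Finite (𝒪[F] ⧸ 𝓂[F]) := inferInstanceAs (Finite 𝓀[F])
    Ideal.finite_quotient_pow (IsNoetherian.noetherian _) _
  have hsurj : ∀ q : (Quotient.mk (QuotientGroup.rightRel (incl F).range) '' {g | InBall ϖ m g}),
      ∃ g : GS F, InBall ϖ m g ∧ Quotient.mk _ g = q.1 := fun q => q.2
  choose rep hrep hrepq using hsurj
  let f : (Quotient.mk (QuotientGroup.rightRel (incl F).range) '' {g | InBall ϖ m g}) →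
      Fin 2 → Fin 2 → 𝒪[F] ⧸ J := fun q i j => Ideal.Quotient.mk J ⟨_, hrep q i j⟩
  refine Set.finite_coe_iff.1 (Finite.of_injective f fun q q' h => ?_)
  have hd : ∀ i j, ∃ c : 𝒪[F], (rep q').1 i j - (rep q).1 i j = (ϖ : F) ^ m * c := by
    intro i j
    have h1 : Ideal.Quotient.mk J ⟨_, hrep q' i j⟩ = Ideal.Quotient.mk J ⟨_, hrep q i j⟩ :=
      (congrFun (congrFun h i) j).symm
    rw [Ideal.Quotient.eq] at h1
    simp only [J, hϖ.maximalIdeal_eq, Ideal.span_singleton_pow] at h1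
    obtain ⟨c, hc⟩ := Ideal.mem_span_singleton.1 h1
    refine ⟨c, ?_⟩
    have h2 := congrArg Subtype.val hc
    refine mul_left_cancel₀ (pow_ne_zero m (uniformizer_ne_zero hϖ)) ?_
    push_cast at h2
    rw [pow_add] at h2
    linear_combination h2
  have hq : InBall ϖ 0 (rep q' * (rep q)⁻¹) := by
    intro i j
    obtain ⟨c, hc⟩ := hd i 0
    obtain ⟨d, hd⟩ := hd i 1
    have h1 : (ϖ : F) ^ 0 * (rep q' * (rep q)⁻¹).1 i j = (1 : GS F).1 i j
        + (c * ((ϖ : F) ^ m * (rep q)⁻¹.1 0 j) + d * ((ϖ : F) ^ m * (rep q)⁻¹.1 1 j)) := by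
      rw [← mul_inv_cancel (rep q), Matrix.SpecialLinearGroup.coe_mul,
        Matrix.SpecialLinearGroup.coe_mul, Matrix.mul_apply, Matrix.mul_apply,
        Fin.sum_univ_two, Fin.sum_univ_two]
      linear_combination hc * (rep q)⁻¹.1 0 j + hd * (rep q)⁻¹.1 1 j
    rw [h1]
    refine add_mem ?_ (add_mem (mul_mem c.2 ((hrep q).inv _ _)) (mul_mem d.2 ((hrep q).inv _ _)))
    have := (inBall_incl (ϖ := ϖ) (1 : K0 F)) i j
    simpa only [map_one, pow_zero, one_mul] using this
  obtain ⟨a, ha⟩ := inBall_zero_iff.1 hq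
  refine Subtype.ext ?_
  rw [← hrepq q, ← hrepq q']
  exact Quotient.sound (QuotientGroup.rightRel_apply.2 ⟨a, ha⟩)

end Geometry

/-! ### The compact induction of a weight -/

section CongruenceSubgroup

variable {F : Type*} [Field F] [ValuativeRel F] (ϖ : 𝒪[F])

/-- The principal congruence subgroup of level `ϖ^N`, as a subgroup of `SL₂(F)`. -/
def congruenceSubgroup (N : ℕ) : Subgroup (GS F) where
  carrier := {g | ∀ i j, ∃ c : 𝒪[F], g.1 i j = (1 : Matrix (Fin 2) (Fin 2) F) i j + (ϖ : F) ^ N * c}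
  one_mem' i j := ⟨0, by simp⟩
  mul_mem' := by
    intro g h hg hh i j
    choose c hc using hg
    choose d hd using hh
    refine ⟨c i j + d i j + ϖ ^ N * (c i 0 * d 0 j + c i 1 * d 1 j), ?_⟩
    have h1 : ∀ x : Fin 2 → F, ∀ i, (1 : Matrix (Fin 2) (Fin 2) F) i 0 * x 0
        + (1 : Matrix (Fin 2) (Fin 2) F) i 1 * x 1 = x i := by
      intro x
      simp [Fin.forall_fin_two]
    have h2 : ∀ x : Fin 2 → F, ∀ j, x 0 * (1 : Matrix (Fin 2) (Fin 2) F) 0 j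
        + x 1 * (1 : Matrix (Fin 2) (Fin 2) F) 1 j = x j := by
      intro x
      simp [Fin.forall_fin_two]
    rw [Matrix.SpecialLinearGroup.coe_mul, Matrix.mul_apply, Fin.sum_univ_two]
    simp only [hc, hd]
    push_cast
    linear_combination h1 (fun i => (1 : Matrix (Fin 2) (Fin 2) F) i j) i
      + (ϖ : F) ^ N * h1 (fun i => (d i j : F)) i + (ϖ : F) ^ N * h2 (fun j => (c i j : F)) j
  inv_mem' := by
    intro g hg i j
    choose c hc using hg
    rw [Matrix.SpecialLinearGroup.coe_inv, Matrix.adjugate_fin_two]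
    fin_cases i <;> fin_cases j
    · exact ⟨c 1 1, by simp [hc]⟩
    · exact ⟨-c 0 1, by simp [hc]⟩
    · exact ⟨-c 1 0, by simp [hc]⟩
    · exact ⟨c 0 0, by simp [hc]⟩

variable {ϖ}

theorem isOpen_congruenceSubgroup [TopologicalSpace F] [IsNonarchimedeanLocalField F]
    (hϖ : Irreducible ϖ) (N : ℕ) : IsOpen (congruenceSubgroup ϖ N : Set (GS F)) := by
  have h0 := pow_ne_zero N (uniformizer_ne_zero hϖ)
  have : (congruenceSubgroup ϖ N : Set (GS F)) = ⋂ i, ⋂ j,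
      (fun g : GS F => ((ϖ : F) ^ N)⁻¹ * (g.1 i j - (1 : Matrix (Fin 2) (Fin 2) F) i j)) ⁻¹'
        (𝒪[F] : Set F) := by
    ext g
    simp only [Set.mem_iInter, Set.mem_preimage, SetLike.mem_coe]
    refine forall_congr' fun i => forall_congr' fun j => ⟨?_, fun h => ⟨⟨_, h⟩, ?_⟩⟩
    · rintro ⟨c, hc⟩
      rw [hc, add_sub_cancel_left, inv_mul_cancel_left₀ h0]
      exact c.2
    · rw [mul_inv_cancel_left₀ h0, add_sub_cancel]
  rw [this]
  refine isOpen_iInter_of_finite fun i => isOpen_iInter_of_finite fun j => ?_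
  refine (Valuation.isOpen_integer (v := ValuativeRel.valuation F)).preimage ?_
  have hc : Continuous fun g : GS F => g.1 i j :=
    (continuous_apply j).comp ((continuous_apply i).comp continuous_subtype_val)
  fun_prop

/-- Conjugates by elements of level at most `m` of the principal congruence subgroup of level
`ϖ^(2m+1)` are congruent to `1` modulo `ϖ`. -/
theorem exists_incl_eq_conj {m : ℕ} {x u : GS F} (hx : InBall ϖ m x)
    (hu : u ∈ congruenceSubgroup ϖ (m + m + 1)) :
    ∃ a : K0 F, incl F a = x * u * x⁻¹ ∧
      ∀ i j, ∃ c, a.1 i j = (1 : Matrix (Fin 2) (Fin 2) 𝒪[F]) i j + ϖ * c := by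
  choose c hc using hu
  have hxx : ∀ i j, x.1 i 0 * x⁻¹.1 0 j + x.1 i 1 * x⁻¹.1 1 j
      = (1 : Matrix (Fin 2) (Fin 2) F) i j := by
    intro i j
    have h := congrArg (fun g : GS F => g.1 i j) (mul_inv_cancel x)
    simp only [Matrix.SpecialLinearGroup.coe_mul, Matrix.mul_apply, Fin.sum_univ_two] at h
    exact h
  have key : ∀ i j, ∃ d : 𝒪[F], (x * u * x⁻¹).1 i j
      = (1 : Matrix (Fin 2) (Fin 2) F) i j + ϖ * d := by
    intro i j
    let X : Fin 2 → Fin 2 → 𝒪[F] := fun i j => ⟨_, hx i j⟩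
    let Y : Fin 2 → Fin 2 → 𝒪[F] := fun i j => ⟨_, hx.inv i j⟩
    refine ⟨(X i 0 * c 0 0 + X i 1 * c 1 0) * Y 0 j + (X i 0 * c 0 1 + X i 1 * c 1 1) * Y 1 j, ?_⟩
    rw [Matrix.SpecialLinearGroup.coe_mul, Matrix.SpecialLinearGroup.coe_mul, Matrix.mul_apply,
      Fin.sum_univ_two, Matrix.mul_apply, Matrix.mul_apply, Fin.sum_univ_two, Fin.sum_univ_two,
      ← hxx i j]
    simp only [hc, X, Y]
    push_cast
    simp only [Matrix.one_apply_eq, Matrix.one_apply_ne (zero_ne_one : (0 : Fin 2) ≠ 1),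
      Matrix.one_apply_ne (one_ne_zero : (1 : Fin 2) ≠ 0)]
    ring
  have hball : InBall ϖ 0 (x * u * x⁻¹) := by
    intro i j
    obtain ⟨d, hd⟩ := key i j
    have h1 : (1 : Matrix (Fin 2) (Fin 2) F) i j ∈ 𝒪[F] := by
      rw [Matrix.one_apply]
      split_ifs
      exacts [one_mem _, zero_mem _]
    rw [pow_zero, one_mul, hd]
    exact add_mem h1 (mul_mem ϖ.2 d.2)
  obtain ⟨a, ha⟩ := inBall_zero_iff.1 hball
  refine ⟨a, ha, fun i j => ?_⟩
  obtain ⟨d, hd⟩ := key i j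
  refine ⟨d, Subtype.ext ?_⟩
  rw [← ha, incl_apply] at hd
  rw [hd]
  push_cast
  rw [Matrix.one_apply, Matrix.one_apply]
  split_ifs <;> rfl

end CongruenceSubgroup

section Induction

variable {F : Type*} [Field F] [ValuativeRel F] [TopologicalSpace F] [IsNonarchimedeanLocalField F]
  {p : ℕ} [Fact p.Prime] [CharP 𝓀[F] p] {k : Type*} [Field k] {ι : 𝓀[F] →+* k} {n : ℕ}
  {r : Fin n → ℕ} {ϖ : 𝒪[F]}

theorem weight_eq_one {a : K0 F} (hϖ : Irreducible ϖ)
    (ha : ∀ i j, ∃ c, a.1 i j = (1 : Matrix (Fin 2) (Fin 2) 𝒪[F]) i j + ϖ * c) :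
    weight p ι r a = 1 := by
  rw [← weightMat_coe, ← map_one (weightMat p ι r)]
  refine weightMat_congr p ι r fun i j => ?_
  obtain ⟨c, hc⟩ := ha i j
  rw [hc, map_add, map_mul, (IsLocalRing.residue_eq_zero_iff ϖ).2
    ((IsLocalRing.mem_maximalIdeal ϖ).2 hϖ.not_isUnit), zero_mul, add_zero]

/-- Every `K₀`-equivariant function of bounded support belongs to the compact induction of a weight:
smoothness is automatic because weights are trivial on a congruence subgroup. -/
noncomputable def cIndOfBounded (hϖ : Irreducible ϖ) (f : GS F → WeightSpace k r)
    (hf : ∀ a g, f (incl F a * g) = weight p ι r a (f g)) (m : ℕ)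
    (hm : ∀ x, f x ≠ 0 → InBall ϖ m x) : CInd (incl F) (weight p ι r) :=
  ⟨⟨f, hf⟩, ⟨congruenceSubgroup ϖ (m + m + 1), isOpen_congruenceSubgroup hϖ _, by
    intro u hu
    refine Subtype.ext (funext fun x => ?_)
    change f (x * u) = f x
    by_cases hx : InBall ϖ m x
    · obtain ⟨a, ha, ha1⟩ := exists_incl_eq_conj hx hu
      rw [show x * u = incl F a * x by rw [ha, inv_mul_cancel_right], hf, weight_eq_one hϖ ha1]
      rfl
    · rw [not_imp_comm.1 (hm x) hx]
      refine not_imp_comm.1 (hm (x * u)) fun hxu => hx ?_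
      obtain ⟨a, ha, -⟩ := exists_incl_eq_conj hxu (inv_mem hu)
      have : x = incl F a * (x * u) := by rw [ha]; group
      rw [this, inBall_incl_mul_iff]
      exact hxu⟩,
    (finite_quotient_ball hϖ m).subset (Set.image_mono hm)⟩

theorem cInd_ext {f f' : CInd (incl F) (weight p ι r)} (h : ∀ x, f.1.1 x = f'.1.1 x) : f = f' :=
  Subtype.ext (Subtype.ext (funext h))

theorem cInd_incl_mul (f : CInd (incl F) (weight p ι r)) (a : K0 F) (x : GS F) :
    f.1.1 (incl F a * x) = weight p ι r a (f.1.1 x) := f.1.2 a x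

theorem cInd_apply (f : CInd (incl F) (weight p ι r)) (g x : GS F) :
    ((cInd (incl F) (weight p ι r)).toRepresentation g f).1.1 x = f.1.1 (x * g) := rfl

theorem weight_injective (a : K0 F) : Function.Injective (weight p ι r a) := by
  refine Function.LeftInverse.injective (g := weight p ι r a⁻¹) fun v => ?_
  rw [← Module.End.mul_apply, ← map_mul, inv_mul_cancel, map_one, Module.End.one_apply]

theorem cInd_incl_mul_eq_zero_iff (f : CInd (incl F) (weight p ι r)) (a : K0 F) (x : GS F) :
    f.1.1 (incl F a * x) = 0 ↔ f.1.1 x = 0 := by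
  rw [cInd_incl_mul, map_eq_zero_iff _ (weight_injective a)]

theorem exists_bound (hϖ : Irreducible ϖ) (f : CInd (incl F) (weight p ι r)) :
    ∃ m, ∀ x, f.1.1 x ≠ 0 → InBall ϖ m x := by
  choose N hN using exists_inBall hϖ
  have hfin := f.2.2
  refine ⟨hfin.toFinset.sup fun q => N q.out, fun x hx => ?_⟩
  have hq : (Quotient.mk (QuotientGroup.rightRel (incl F).range) x) ∈ hfin.toFinset :=
    hfin.mem_toFinset.2 ⟨x, hx, rfl⟩
  have hle := Finset.le_sup (f := fun q => N q.out) hq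
  obtain ⟨a, ha⟩ := exists_incl_mul_out x
  have hb := (hN (Quotient.mk (QuotientGroup.rightRel (incl F).range) x).out).mono hle
  rwa [← inBall_incl_mul_iff a, ha] at hb

end Induction

section StdFun

variable {F : Type*} [Field F] [ValuativeRel F] {k W : Type*} [Field k] [AddCommGroup W]
  [Module k W]
  {σ : Representation k (K0 F) W}

theorem stdFun_apply_of_eq {g x : GS F} {a : K0 F} (h : incl F a = x * g) (v : W) :
    stdFun (incl F) σ g v x = σ a v := by
  have hex : ∃ a : K0 F, incl F a = x * g := ⟨a, h⟩
  rw [stdFun, dif_pos hex, incl_injective (hex.choose_spec.trans h.symm)]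

theorem stdFun_apply_of_not_exists {g x : GS F} (h : ¬ ∃ a : K0 F, incl F a = x * g) (v : W) :
    stdFun (incl F) σ g v x = 0 := dif_neg h

theorem stdFun_mul (g h : GS F) (v : W) (x : GS F) :
    stdFun (incl F) σ (g * h) v x = stdFun (incl F) σ h v (x * g) := by
  have : x * g * h = x * (g * h) := mul_assoc x g h
  simp only [stdFun]
  rw [this]

theorem stdFun_incl (a : K0 F) (v : W) :
    stdFun (incl F) σ (incl F a) v = stdFun (incl F) σ 1 (σ a v) := by
  funext x
  by_cases hx : ∃ b : K0 F, incl F b = x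
  · obtain ⟨b, rfl⟩ := hx
    rw [stdFun_apply_of_eq (a := b * a) (map_mul _ _ _),
      stdFun_apply_of_eq (a := b) (mul_one _).symm,
      map_mul, Module.End.mul_apply]
  · rw [stdFun_apply_of_not_exists, stdFun_apply_of_not_exists]
    · rwa [mul_one]
    · rintro ⟨b, hb⟩
      exact hx ⟨b * a⁻¹, by rw [map_mul, map_inv, hb, mul_inv_cancel_right]⟩

theorem stdFun_incl_mul (a : K0 F) (g x : GS F) (v : W) :
    stdFun (incl F) σ g v (incl F a * x) = σ a (stdFun (incl F) σ g v x) := by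
  by_cases hx : ∃ b : K0 F, incl F b = x * g
  · obtain ⟨b, hb⟩ := hx
    rw [stdFun_apply_of_eq hb, stdFun_apply_of_eq (a := a * b) (by rw [map_mul, hb, mul_assoc]),
      map_mul, Module.End.mul_apply]
  · rw [stdFun_apply_of_not_exists hx, stdFun_apply_of_not_exists, map_zero]
    rintro ⟨b, hb⟩
    exact hx ⟨a⁻¹ * b, by rw [map_mul, hb, map_inv, mul_assoc, inv_mul_cancel_left]⟩

end StdFun

section Induction

variable {F : Type*} [Field F] [ValuativeRel F] [TopologicalSpace F] [IsNonarchimedeanLocalField F]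
  {p : ℕ} [Fact p.Prime] [CharP 𝓀[F] p] {k : Type*} [Field k] {ι : 𝓀[F] →+* k} {n : ℕ}
  {r : Fin n → ℕ} {ϖ : 𝒪[F]}

theorem inBall_of_stdFun_ne_zero {m : ℕ} {g x : GS F} (hg : InBall ϖ m g) {v : WeightSpace k r}
    (h : stdFun (incl F) (weight p ι r) g v x ≠ 0) : InBall ϖ m x := by
  by_cases hx : ∃ a : K0 F, incl F a = x * g
  · obtain ⟨a, ha⟩ := hx
    rw [show x = incl F a * g⁻¹ by rw [ha, mul_inv_cancel_right], inBall_incl_mul_iff]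
    exact hg.inv
  · exact absurd (stdFun_apply_of_not_exists hx v) h

/-- The standard function `[g, v]`, as an element of the compact induction. -/
noncomputable def stdElt (hϖ : Irreducible ϖ) (ι : 𝓀[F] →+* k) (g : GS F) (v : WeightSpace k r) :
    CInd (incl F) (weight p ι r) :=
  cIndOfBounded hϖ (stdFun (incl F) (weight p ι r) g v) (fun a x => stdFun_incl_mul a g x v)
    (exists_inBall hϖ g).choose fun _ => inBall_of_stdFun_ne_zero (exists_inBall hϖ g).choose_spec

theorem stdElt_apply (hϖ : Irreducible ϖ) (g : GS F) (v : WeightSpace k r) (x : GS F) :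
    (stdElt (p := p) hϖ ι g v).1.1 x = stdFun (incl F) (weight p ι r) g v x := rfl

theorem stdElt_eq (hϖ : Irreducible ϖ) (g : GS F) (v : WeightSpace k r) :
    stdElt (p := p) hϖ ι g v
      = (cInd (incl F) (weight p ι r)).toRepresentation g (stdElt hϖ ι 1 v) :=
  cInd_ext fun x => by rw [cInd_apply, stdElt_apply, stdElt_apply, ← stdFun_mul, mul_one]

theorem stdElt_incl (hϖ : Irreducible ϖ) (a : K0 F) (v : WeightSpace k r) :
    stdElt (p := p) hϖ ι (incl F a) v = stdElt hϖ ι 1 (weight p ι r a v) :=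
  cInd_ext fun x => by rw [stdElt_apply, stdElt_apply, stdFun_incl]

theorem stdElt_add (hϖ : Irreducible ϖ) (g : GS F) (v w : WeightSpace k r) :
    stdElt (p := p) hϖ ι g (v + w) = stdElt hϖ ι g v + stdElt hϖ ι g w := by
  refine cInd_ext fun x => ?_
  change stdFun (incl F) (weight p ι r) g (v + w) x
    = stdFun (incl F) (weight p ι r) g v x + stdFun (incl F) (weight p ι r) g w x
  by_cases hx : ∃ a : K0 F, incl F a = x * g
  · obtain ⟨a, ha⟩ := hx
    simp only [stdFun_apply_of_eq ha, map_add]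
  · simp only [stdFun_apply_of_not_exists hx, add_zero]

theorem stdElt_smul (hϖ : Irreducible ϖ) (g : GS F) (c : k) (v : WeightSpace k r) :
    stdElt (p := p) hϖ ι g (c • v) = c • stdElt hϖ ι g v := by
  refine cInd_ext fun x => ?_
  change stdFun (incl F) (weight p ι r) g (c • v) x = c • stdFun (incl F) (weight p ι r) g v x
  by_cases hx : ∃ a : K0 F, incl F a = x * g
  · obtain ⟨a, ha⟩ := hx
    simp only [stdFun_apply_of_eq ha, map_smul]
  · simp only [stdFun_apply_of_not_exists hx, smul_zero]

theorem exists_eq_sum_stdElt (hϖ : Irreducible ϖ) (f : CInd (incl F) (weight p ι r)) :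
    ∃ (s : Finset (Quotient (QuotientGroup.rightRel (incl F).range))),
      f = ∑ q ∈ s, stdElt hϖ ι q.out⁻¹ (f.1.1 q.out) := by
  classical
  refine ⟨f.2.2.toFinset, cInd_ext fun x => ?_⟩
  have hsum : ∀ s : Finset (Quotient (QuotientGroup.rightRel (incl F).range)),
      (∑ q ∈ s, stdElt (p := p) hϖ ι q.out⁻¹ (f.1.1 q.out)).1.1 x
        = ∑ q ∈ s, stdFun (incl F) (weight p ι r) q.out⁻¹ (f.1.1 q.out) x := by
    intro s
    induction s using Finset.induction_on with
    | empty => rfl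
    | insert q s hq ih => rw [Finset.sum_insert hq, Finset.sum_insert hq, ← ih]; rfl
  rw [hsum, Finset.sum_eq_single (Quotient.mk _ x)]
  · obtain ⟨a, ha⟩ := exists_incl_mul_out x
    rw [stdFun_apply_of_eq (eq_mul_inv_of_mul_eq ha), ← cInd_incl_mul, ha]
  · intro q _ hq
    refine stdFun_apply_of_not_exists ?_ _
    rintro ⟨a, ha⟩
    refine hq ?_
    rw [← Quotient.out_eq q]
    exact Quotient.sound (QuotientGroup.rightRel_apply.2 ⟨a, ha⟩)
  · intro hx
    have hx0 : f.1.1 x = 0 := by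
      by_contra h
      exact hx (f.2.2.mem_toFinset.2 ⟨x, h, rfl⟩)
    obtain ⟨a, ha⟩ := exists_incl_mul_out x
    rw [stdFun_apply_of_eq (eq_mul_inv_of_mul_eq ha), ← cInd_incl_mul, ha, hx0]

/-- A Hecke operator is determined by its values on the functions `[1, v]`. -/
theorem heckeAlgebra_ext (hϖ : Irreducible ϖ) {T T' : HeckeAlgebra (incl F) (weight p ι r)}
    (h : ∀ v, T (stdElt hϖ ι 1 v) = T' (stdElt hϖ ι 1 v)) : T = T' := by
  refine Representation.IntertwiningMap.ext (LinearMap.ext fun f => ?_)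
  obtain ⟨s, hs⟩ := exists_eq_sum_stdElt hϖ f
  rw [hs, map_sum, map_sum]
  refine Finset.sum_congr rfl fun q _ => ?_
  rw [stdElt_eq, Representation.IntertwiningMap.toLinearMap_apply,
    Representation.IntertwiningMap.toLinearMap_apply, T.isIntertwining, T'.isIntertwining, h]

end Induction

/-! ### The Hecke operator `τ` -/

section HeckeOperator

variable {F : Type*} [Field F] [ValuativeRel F] [TopologicalSpace F] [IsNonarchimedeanLocalField F]
  {p : ℕ} [Fact p.Prime] [CharP 𝓀[F] p] {k : Type*} [Field k] {ι : 𝓀[F] →+* k} {n : ℕ}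
  {r : Fin n → ℕ} {ϖ : 𝒪[F]}

open Classical in
/-- The function `K₀ α₀ K₀ → End σ_r` that defines the operator `τ` by convolution: its value at
`g` is the action of the singular matrix `ϖ g` modulo `ϖ`. It is extended by zero to `SL₂(F)`. -/
noncomputable def heckeKernel (p : ℕ) [Fact p.Prime] [CharP 𝓀[F] p] (ι : 𝓀[F] →+* k) (r : Fin n → ℕ)
    (ϖ : 𝒪[F]) (g : GS F) : Module.End k (WeightSpace k r) :=
  if h : OnSphere ϖ 1 g then
    weightMat p ι r (Matrix.of fun i j => ⟨(ϖ : F) ^ 1 * g.1 i j, h.1 i j⟩) else 0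

theorem heckeKernel_eq {g : GS F} (h : OnSphere ϖ 1 g) {M : Matrix (Fin 2) (Fin 2) 𝒪[F]}
    (hM : ∀ i j, (M i j : F) = (ϖ : F) ^ 1 * g.1 i j) :
    heckeKernel p ι r ϖ g = weightMat p ι r M := by
  rw [heckeKernel, dif_pos h]
  congr 1
  ext i j
  exact (hM i j).symm

theorem heckeKernel_of_not {g : GS F} (h : ¬ OnSphere ϖ 1 g) : heckeKernel p ι r ϖ g = 0 :=
  dif_neg h

theorem heckeKernel_incl_mul (a : K0 F) (g : GS F) :
    heckeKernel p ι r ϖ (incl F a * g) = weight p ι r a * heckeKernel p ι r ϖ g := by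
  by_cases h : OnSphere ϖ 1 g
  · rw [heckeKernel_eq h (M := Matrix.of fun i j => ⟨_, h.1 i j⟩) (fun _ _ => rfl),
      heckeKernel_eq ((onSphere_incl_mul_iff a).2 h)
        (M := a.1 * Matrix.of fun i j => ⟨_, h.1 i j⟩), map_mul, ← weightMat_coe]
    intro i j
    rw [Matrix.mul_apply, Fin.sum_univ_two, Matrix.SpecialLinearGroup.coe_mul, Matrix.mul_apply,
      Fin.sum_univ_two, incl_apply, incl_apply]
    push_cast
    simp only [Matrix.of_apply]
    ring
  · rw [heckeKernel_of_not h, heckeKernel_of_not (mt (onSphere_incl_mul_iff a).1 h), mul_zero]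

theorem heckeKernel_mul_incl (g : GS F) (a : K0 F) :
    heckeKernel p ι r ϖ (g * incl F a) = heckeKernel p ι r ϖ g * weight p ι r a := by
  by_cases h : OnSphere ϖ 1 g
  · rw [heckeKernel_eq h (M := Matrix.of fun i j => ⟨_, h.1 i j⟩) (fun _ _ => rfl),
      heckeKernel_eq ((onSphere_mul_incl_iff a).2 h)
        (M := (Matrix.of fun i j => ⟨_, h.1 i j⟩) * a.1), map_mul, ← weightMat_coe]
    intro i j
    rw [Matrix.mul_apply, Fin.sum_univ_two, Matrix.SpecialLinearGroup.coe_mul, Matrix.mul_apply,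
      Fin.sum_univ_two, incl_apply, incl_apply]
    push_cast
    simp only [Matrix.of_apply]
    ring
  · rw [heckeKernel_of_not h, heckeKernel_of_not (mt (onSphere_mul_incl_iff a).1 h), zero_mul]

theorem heckeKernel_alpha0_inv (hϖ : Irreducible ϖ) :
    heckeKernel p ι r ϖ (alpha0 hϖ)⁻¹ = weightU k r := by
  have h0 := uniformizer_ne_zero hϖ
  have hs := onSphere_alpha0_pow_inv hϖ 1
  have hv := alpha0_pow_inv_val hϖ 1
  rw [pow_one] at hs hv
  have hres : IsLocalRing.residue 𝒪[F] ϖ = 0 := (IsLocalRing.residue_eq_zero_iff ϖ).2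
    ((IsLocalRing.mem_maximalIdeal ϖ).2 hϖ.not_isUnit)
  rw [heckeKernel_eq hs (M := !![ϖ * ϖ, 0; 0, 1]), ← weightMat_diag p ι r]
  · refine weightMat_congr p ι r fun i j => ?_
    fin_cases i <;> fin_cases j <;> simp [hres]
  · intro i j
    rw [hv]
    fin_cases i <;> fin_cases j <;> simp [h0]

theorem heckeKernel_alpha0 (hϖ : Irreducible ϖ) :
    heckeKernel p ι r ϖ (alpha0 hϖ)
      = weight p ι r w0 * weightU k r * weight p ι r w0⁻¹ := by
  have h := w0_mul_alpha0_pow_inv hϖ 1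
  rw [pow_one] at h
  have h2 : alpha0 hϖ = incl F w0 * (alpha0 hϖ)⁻¹ * incl F w0⁻¹ := by
    rw [h, map_inv, mul_inv_cancel_right]
  conv_lhs => rw [h2]
  rw [heckeKernel_mul_incl, heckeKernel_incl_mul, heckeKernel_alpha0_inv]

theorem finite_leftCosets (hϖ : Irreducible ϖ) :
    {q : GS F ⧸ (incl F).range | InBall ϖ 1 q.out}.Finite := by
  refine Set.Finite.of_finite_image (f := fun q : GS F ⧸ (incl F).range =>
    Quotient.mk (QuotientGroup.rightRel (incl F).range) q.out⁻¹)
    ((finite_quotient_ball hϖ 1).subset ?_) ?_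
  · rintro _ ⟨q, hq, rfl⟩
    exact ⟨_, InBall.inv hq, rfl⟩
  · intro q _ q' _ h
    have h1 := QuotientGroup.rightRel_apply.1 (Quotient.exact h)
    rw [inv_inv, ← QuotientGroup.eq, QuotientGroup.out_eq', QuotientGroup.out_eq'] at h1
    exact h1.symm

theorem heckeKernel_apply_congr (f : CInd (incl F) (weight p ι r)) (x : GS F) {y y' : GS F}
    (h : (y : GS F ⧸ (incl F).range) = y') :
    heckeKernel p ι r ϖ y (f.1.1 (y⁻¹ * x)) = heckeKernel p ι r ϖ y' (f.1.1 (y'⁻¹ * x)) := by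
  obtain ⟨a, ha⟩ := MonoidHom.mem_range.1 (QuotientGroup.eq.1 h)
  have hy : y' = y * incl F a := by rw [ha, mul_inv_cancel_left]
  rw [hy, heckeKernel_mul_incl, _root_.mul_inv_rev, mul_assoc, ← map_inv, cInd_incl_mul,
    Module.End.mul_apply, ← Module.End.mul_apply (weight p ι r a), ← map_mul, mul_inv_cancel,
    map_one, Module.End.one_apply]

theorem heckeKernel_apply_out (f : CInd (incl F) (weight p ι r)) (x y : GS F) :
    heckeKernel p ι r ϖ (y : GS F ⧸ (incl F).range).out
        (f.1.1 ((y : GS F ⧸ (incl F).range).out⁻¹ * x))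
      = heckeKernel p ι r ϖ y (f.1.1 (y⁻¹ * x)) :=
  heckeKernel_apply_congr f x (QuotientGroup.out_eq' _)

/-- The convolution of `f` with the Hecke kernel. -/
noncomputable def heckeFun (hϖ : Irreducible ϖ) (f : CInd (incl F) (weight p ι r)) (x : GS F) :
    WeightSpace k r :=
  ∑ q ∈ (finite_leftCosets hϖ).toFinset, heckeKernel p ι r ϖ q.out (f.1.1 (q.out⁻¹ * x))

theorem heckeFun_incl_mul (hϖ : Irreducible ϖ) (f : CInd (incl F) (weight p ι r)) (a : K0 F)
    (x : GS F) : heckeFun hϖ f (incl F a * x) = weight p ι r a (heckeFun hϖ f x) := by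
  rw [heckeFun, heckeFun, map_sum]
  refine (Finset.sum_equiv (MulAction.toPerm (incl F a)) (fun q => ?_) fun q _ => ?_).symm
  · induction q using QuotientGroup.induction_on with
    | H y =>
      rw [Set.Finite.mem_toFinset, Set.Finite.mem_toFinset, MulAction.toPerm_apply,
        MulAction.Quotient.smul_coe, Set.mem_ofPred_eq, Set.mem_ofPred_eq, inBall_out_iff,
        inBall_out_iff, smul_eq_mul, inBall_incl_mul_iff]
  · induction q using QuotientGroup.induction_on with
    | H y =>
      rw [MulAction.toPerm_apply, MulAction.Quotient.smul_coe, heckeKernel_apply_out,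
        heckeKernel_apply_out, smul_eq_mul, heckeKernel_incl_mul, _root_.mul_inv_rev, mul_assoc,
        inv_mul_cancel_left, Module.End.mul_apply]

theorem inBall_of_heckeFun_ne_zero (hϖ : Irreducible ϖ) {f : CInd (incl F) (weight p ι r)} {m : ℕ}
    (hf : ∀ x, f.1.1 x ≠ 0 → InBall ϖ m x) (x : GS F) (hx : heckeFun hϖ f x ≠ 0) :
    InBall ϖ (m + 1) x := by
  obtain ⟨q, hq, hqx⟩ := Finset.exists_ne_zero_of_sum_ne_zero hx
  have h1 : f.1.1 (q.out⁻¹ * x) ≠ 0 := fun h => hqx (by rw [h, map_zero])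
  have h2 : InBall ϖ 1 q.out := (finite_leftCosets hϖ).mem_toFinset.1 hq
  have h3 := h2.mul (hf _ h1)
  rwa [mul_inv_cancel_left, add_comm] at h3

/-- The Hecke operator `τ`: convolution with the Hecke kernel. -/
noncomputable def heckeOperator (hϖ : Irreducible ϖ) (p : ℕ) [Fact p.Prime] [CharP 𝓀[F] p]
    (ι : 𝓀[F] →+* k) (r : Fin n → ℕ) : HeckeAlgebra (incl F) (weight p ι r) :=
  LinearMap.intertwiningMap_of_isIntertwiningMap _ _
    { toFun f := cIndOfBounded hϖ (heckeFun hϖ f) (heckeFun_incl_mul hϖ f)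
        ((exists_bound hϖ f).choose + 1)
        (inBall_of_heckeFun_ne_zero hϖ (exists_bound hϖ f).choose_spec)
      map_add' f f' := cInd_ext fun x => by
        change heckeFun hϖ (f + f') x = heckeFun hϖ f x + heckeFun hϖ f' x
        rw [heckeFun, heckeFun, heckeFun, ← Finset.sum_add_distrib]
        exact Finset.sum_congr rfl fun q _ => map_add _ _ _
      map_smul' c f := cInd_ext fun x => by
        change heckeFun hϖ (c • f) x = c • heckeFun hϖ f x
        rw [heckeFun, heckeFun, Finset.smul_sum]
        exact Finset.sum_congr rfl fun q _ => map_smul (heckeKernel p ι r ϖ q.out) c _ }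
    (fun g f => cInd_ext fun x => by
      change heckeFun hϖ _ x = heckeFun hϖ f (x * g)
      rw [heckeFun, heckeFun]
      exact Finset.sum_congr rfl fun q _ => by rw [cInd_apply, mul_assoc])

theorem heckeOperator_apply (hϖ : Irreducible ϖ) (f : CInd (incl F) (weight p ι r)) (x : GS F) :
    (heckeOperator hϖ p ι r f).1.1 x = heckeFun hϖ f x := rfl

/-- If `f` vanishes at `y⁻¹ x` for all neighbours `y` of the central vertex except for one, then the
convolution at `x` has only one term. -/
theorem heckeOperator_apply_eq (hϖ : Irreducible ϖ) (f : CInd (incl F) (weight p ι r)) (x y : GS F)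
    (h : ∀ z, InBall ϖ 1 z → f.1.1 (z⁻¹ * x) ≠ 0 → ∃ a, z = y * incl F a) :
    (heckeOperator hϖ p ι r f).1.1 x = heckeKernel p ι r ϖ y (f.1.1 (y⁻¹ * x)) := by
  rw [heckeOperator_apply, heckeFun, Finset.sum_eq_single (y : GS F ⧸ (incl F).range)]
  · exact heckeKernel_apply_out f x y
  · intro q hq hqy
    by_contra hne
    have h1 : f.1.1 (q.out⁻¹ * x) ≠ 0 := fun h => hne (by rw [h, map_zero])
    obtain ⟨a, ha⟩ := h _ ((finite_leftCosets hϖ).mem_toFinset.1 hq) h1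
    refine hqy ?_
    rw [← QuotientGroup.out_eq' q, eq_comm, QuotientGroup.eq, ha, inv_mul_cancel_left]
    exact ⟨a, rfl⟩
  · intro hy
    rw [heckeKernel_apply_out, heckeKernel_of_not, LinearMap.zero_apply]
    intro hs
    exact hy ((finite_leftCosets hϖ).mem_toFinset.2 ((inBall_out_iff y).2 hs.1))

theorem heckeOperator_stdElt (hϖ : Irreducible ϖ) (g : GS F) (v : WeightSpace k r) (x : GS F) :
    (heckeOperator hϖ p ι r (stdElt hϖ ι g v)).1.1 x = heckeKernel p ι r ϖ (x * g) v := by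
  rw [heckeOperator_apply_eq hϖ _ _ (x * g), stdElt_apply, stdFun_apply_of_eq (a := 1), map_one,
    Module.End.one_apply]
  · rw [map_one]; group
  · intro z _ hz
    rw [stdElt_apply] at hz
    by_cases hx : ∃ a : K0 F, incl F a = z⁻¹ * x * g
    · obtain ⟨a, ha⟩ := hx
      exact ⟨a⁻¹, by rw [map_inv, ha]; group⟩
    · exact absurd (stdFun_apply_of_not_exists hx v) hz

end HeckeOperator

/-! ### Coset representatives for `K₀ α₀ K₀` -/

section Neighbours

variable {F : Type*} [Field F] [ValuativeRel F] {ϖ : 𝒪[F]} (hϖ : Irreducible ϖ)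

theorem dvd_of_coe_mul_mem (hϖ : Irreducible ϖ) {m : ℕ} {x : 𝒪[F]}
    (h : ((ϖ : F) ^ m)⁻¹ * x ∈ 𝒪[F]) : ϖ ^ m ∣ x := by
  refine ⟨⟨_, h⟩, Subtype.ext ?_⟩
  push_cast
  rw [mul_inv_cancel_left₀ (pow_ne_zero m (uniformizer_ne_zero hϖ))]

theorem coe_mul_mem_of_dvd (hϖ : Irreducible ϖ) {m : ℕ} {x : 𝒪[F]} (h : ϖ ^ m ∣ x) :
    ((ϖ : F) ^ m)⁻¹ * x ∈ 𝒪[F] := by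
  obtain ⟨c, rfl⟩ := h
  push_cast
  rw [inv_mul_cancel_left₀ (pow_ne_zero m (uniformizer_ne_zero hϖ))]
  exact c.2

theorem alpha0_val : (alpha0 hϖ).1 = !![(ϖ : F)⁻¹, 0; 0, (ϖ : F)] := rfl

theorem alpha0_inv_val : (alpha0 hϖ)⁻¹.1 = !![(ϖ : F), 0; 0, (ϖ : F)⁻¹] := by
  have := alpha0_pow_inv_val hϖ 1
  rwa [pow_one, pow_one] at this

theorem inBall_upper_upper_iff (t x : 𝒪[F]) :
    InBall ϖ 0 (alpha0 hϖ * incl F (upper t) * (incl F (upper x) * (alpha0 hϖ)⁻¹))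
      ↔ ϖ ^ 2 ∣ t + x := by
  have h0 := uniformizer_ne_zero hϖ
  have hval : (alpha0 hϖ * incl F (upper t) * (incl F (upper x) * (alpha0 hϖ)⁻¹)).1
      = !![1, ((ϖ : F) ^ 2)⁻¹ * ((t + x : 𝒪[F]) : F); 0, 1] := by
    rw [Matrix.SpecialLinearGroup.coe_mul, Matrix.SpecialLinearGroup.coe_mul,
      Matrix.SpecialLinearGroup.coe_mul, incl_upper, incl_upper, upper_val, upper_val, alpha0_val,
      alpha0_inv_val, Matrix.mul_fin_two, Matrix.mul_fin_two, Matrix.mul_fin_two]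
    ext i j
    fin_cases i <;> fin_cases j <;> simp [h0]
    field_simp
    ring
  constructor
  · intro h
    have h1 := h 0 1
    rw [hval] at h1
    exact dvd_of_coe_mul_mem hϖ (by simpa using h1)
  · intro h i j
    rw [hval]
    have := coe_mul_mem_of_dvd hϖ h
    fin_cases i <;> fin_cases j
    · simp [one_mem]
    · simpa using this
    · simp [zero_mem]
    · simp [one_mem]

theorem inBall_lower_lower_iff (c x : 𝒪[F]) :
    InBall ϖ 0 ((alpha0 hϖ)⁻¹ * incl F (lower (ϖ * c)) * (incl F (lower (ϖ * x)) * alpha0 hϖ))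
      ↔ ϖ ∣ c + x := by
  have h0 := uniformizer_ne_zero hϖ
  have hval : ((alpha0 hϖ)⁻¹ * incl F (lower (ϖ * c)) * (incl F (lower (ϖ * x)) * alpha0 hϖ)).1
      = !![1, 0; ((ϖ : F) ^ 1)⁻¹ * ((c + x : 𝒪[F]) : F), 1] := by
    rw [Matrix.SpecialLinearGroup.coe_mul, Matrix.SpecialLinearGroup.coe_mul,
      Matrix.SpecialLinearGroup.coe_mul, incl_lower, incl_lower, lower_val, lower_val, alpha0_val,
      alpha0_inv_val, Matrix.mul_fin_two, Matrix.mul_fin_two, Matrix.mul_fin_two]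
    ext i j
    fin_cases i <;> fin_cases j <;> simp [h0]
    field_simp
  constructor
  · intro h
    have h1 := h 1 0
    rw [hval] at h1
    simpa using dvd_of_coe_mul_mem hϖ (m := 1) (by simpa using h1)
  · intro h i j
    rw [hval]
    have := coe_mul_mem_of_dvd hϖ (m := 1) (by simpa using h)
    fin_cases i <;> fin_cases j
    · simp [one_mem]
    · simp [zero_mem]
    · simpa using this
    · simp [one_mem]

theorem not_inBall_upper_lower (t x : 𝒪[F]) :
    ¬ InBall ϖ 0 (alpha0 hϖ * incl F (upper t) * (incl F (lower (ϖ * x)) * alpha0 hϖ)) := by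
  have h0 := uniformizer_ne_zero hϖ
  intro h
  have h1 := h 0 0
  rw [Matrix.SpecialLinearGroup.coe_mul, Matrix.SpecialLinearGroup.coe_mul,
    Matrix.SpecialLinearGroup.coe_mul, incl_upper, incl_lower, upper_val, lower_val, alpha0_val,
    Matrix.mul_fin_two, Matrix.mul_fin_two, Matrix.mul_fin_two] at h1
  have h2 : ((ϖ : F) ^ 1)⁻¹ * ((1 + ϖ * (t * x) : 𝒪[F]) : F) ∈ 𝒪[F] := by
    have h3 := mul_mem ϖ.2 h1
    convert h3 using 1
    push_cast
    simp
    field_simp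
  have h3 := dvd_of_coe_mul_mem hϖ h2
  rw [pow_one, dvd_add_left (dvd_mul_right _ _)] at h3
  exact hϖ.not_isUnit (isUnit_of_dvd_one h3)

theorem not_inBall_lower_upper (c x : 𝒪[F]) :
    ¬ InBall ϖ 0 ((alpha0 hϖ)⁻¹ * incl F (lower (ϖ * c)) * (incl F (upper x) * (alpha0 hϖ)⁻¹)) := by
  have h0 := uniformizer_ne_zero hϖ
  intro h
  have h1 := h 1 1
  rw [Matrix.SpecialLinearGroup.coe_mul, Matrix.SpecialLinearGroup.coe_mul,
    Matrix.SpecialLinearGroup.coe_mul, incl_upper, incl_lower, upper_val, lower_val, alpha0_inv_val,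
    Matrix.mul_fin_two, Matrix.mul_fin_two, Matrix.mul_fin_two] at h1
  have h2 : ((ϖ : F) ^ 1)⁻¹ * ((1 + ϖ * (c * x) : 𝒪[F]) : F) ∈ 𝒪[F] := by
    have h3 := mul_mem ϖ.2 h1
    convert h3 using 1
    push_cast
    simp
    field_simp
    ring
  have h3 := dvd_of_coe_mul_mem hϖ h2
  rw [pow_one, dvd_add_left (dvd_mul_right _ _)] at h3
  exact hϖ.not_isUnit (isUnit_of_dvd_one h3)

variable [TopologicalSpace F] [IsNonarchimedeanLocalField F]

theorem dvd_iff_residue_eq_zero (hϖ : Irreducible ϖ) (x : 𝒪[F]) :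
    ϖ ∣ x ↔ IsLocalRing.residue 𝒪[F] x = 0 := by
  rw [IsLocalRing.residue_eq_zero_iff, hϖ.maximalIdeal_eq, Ideal.mem_span_singleton]

theorem dvd_add_iff_eq (hϖ : Irreducible ϖ) {s : 𝓀[F] → 𝒪[F]}
    (hs : ∀ x, IsLocalRing.residue 𝒪[F] (s x) = x) (c : 𝒪[F]) (m : 𝓀[F]) :
    ϖ ∣ c + s m ↔ m = -IsLocalRing.residue 𝒪[F] c := by
  rw [dvd_iff_residue_eq_zero hϖ, map_add, hs, add_comm, add_eq_zero_iff_eq_neg]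

theorem exists_forall_sq_dvd_iff (hϖ : Irreducible ϖ) {s : 𝓀[F] → 𝒪[F]}
    (hs : ∀ x, IsLocalRing.residue 𝒪[F] (s x) = x) (t : 𝒪[F]) :
    ∃ l₀ : 𝓀[F] × 𝓀[F], ∀ l : 𝓀[F] × 𝓀[F], ϖ ^ 2 ∣ t + (s l.1 + s l.2 * ϖ) ↔ l = l₀ := by
  obtain ⟨c, hc⟩ := (dvd_add_iff_eq hϖ hs t _).2 rfl
  refine ⟨(-IsLocalRing.residue 𝒪[F] t, -IsLocalRing.residue 𝒪[F] c), ?_⟩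
  have key : ∀ m, ϖ ^ 2 ∣ t + (s (-IsLocalRing.residue 𝒪[F] t) + s m * ϖ)
      ↔ m = -IsLocalRing.residue 𝒪[F] c := by
    intro m
    rw [← dvd_add_iff_eq hϖ hs, ← add_assoc, hc, mul_comm (s m), ← mul_add, sq,
      mul_dvd_mul_iff_left hϖ.ne_zero]
  rintro ⟨l₁, l₂⟩
  constructor
  · intro h
    have h1 : ϖ ∣ t + s l₁ := by
      have h2 : ϖ ∣ t + (s l₁ + s l₂ * ϖ) := (dvd_pow_self ϖ two_ne_zero).trans h
      rwa [← add_assoc, dvd_add_left (Dvd.intro_left (s l₂) rfl)] at h2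
    obtain rfl := (dvd_add_iff_eq hϖ hs t l₁).1 h1
    rw [(key l₂).1 h]
  · rintro h
    obtain ⟨rfl, rfl⟩ := Prod.mk_inj.1 h
    exact (key _).2 rfl

end Neighbours

section HeckeFormula

variable {F : Type*} [Field F] [ValuativeRel F] [TopologicalSpace F] [IsNonarchimedeanLocalField F]
  {p : ℕ} [Fact p.Prime] [CharP 𝓀[F] p] {k : Type*} [Field k] {ι : 𝓀[F] →+* k} {n : ℕ}
  {r : Fin n → ℕ} {ϖ : 𝒪[F]}

theorem heckeKernel_upper_inv (hϖ : Irreducible ϖ) (x : 𝒪[F]) :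
    heckeKernel p ι r ϖ (incl F (upper x) * (alpha0 hϖ)⁻¹)⁻¹
      = weight p ι r w0 * weightU k r * weight p ι r (w0u x) := by
  have h : (w0u x : K0 F) = w0⁻¹ * (upper x)⁻¹ := by
    refine Matrix.SpecialLinearGroup.ext _ _ fun i j => ?_
    rw [Matrix.SpecialLinearGroup.coe_mul, Matrix.SpecialLinearGroup.coe_inv,
      Matrix.SpecialLinearGroup.coe_inv, w0, upper, w0u, Matrix.adjugate_fin_two,
      Matrix.adjugate_fin_two]
    fin_cases i <;> fin_cases j <;> simp [Matrix.mul_apply, Fin.sum_univ_two]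
  rw [_root_.mul_inv_rev, inv_inv, ← map_inv, heckeKernel_mul_incl, heckeKernel_alpha0, h, map_mul,
    mul_assoc _ (weight p ι r w0⁻¹)]

theorem heckeKernel_lower_inv (hϖ : Irreducible ϖ) (x : 𝒪[F]) :
    heckeKernel p ι r ϖ (incl F (lower (ϖ * x)) * alpha0 hϖ)⁻¹ = weightU k r := by
  rw [_root_.mul_inv_rev, ← map_inv, heckeKernel_mul_incl, heckeKernel_alpha0_inv,
    weight_eq_one hϖ, mul_one]
  intro i j
  rw [Matrix.SpecialLinearGroup.coe_inv, lower, Matrix.adjugate_fin_two]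
  fin_cases i <;> fin_cases j
  · exact ⟨0, by simp⟩
  · exact ⟨0, by simp⟩
  · exact ⟨-x, by simp⟩
  · exact ⟨0, by simp⟩

theorem stdFun_mul_heckeKernel_of_inBall {g x y : GS F} (h : InBall ϖ 0 (x * g * y))
    (v : WeightSpace k r) :
    stdFun (incl F) (weight p ι r) (g * y) (heckeKernel p ι r ϖ y⁻¹ v) x
      = heckeKernel p ι r ϖ (x * g) v := by
  obtain ⟨a, ha⟩ := inBall_zero_iff.1 h
  rw [stdFun_apply_of_eq (a := a) (by rw [ha, mul_assoc]), ← Module.End.mul_apply,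
    ← heckeKernel_incl_mul, ha, mul_inv_cancel_right]

theorem stdFun_mul_of_not_inBall {g x y : GS F} (h : ¬ InBall ϖ 0 (x * g * y))
    (v : WeightSpace k r) :
    stdFun (incl F) (weight p ι r) (g * y) v x = 0 :=
  stdFun_apply_of_not_exists (fun ⟨a, ha⟩ => h (inBall_zero_iff.2 ⟨a, by rw [ha, mul_assoc]⟩)) v

/-- The explicit formula for `τ`. Both sides vanish at `x` unless `x g ∈ K₀ α₀ K₀`, and then exactly
one of the summands is supported at `x`, the one that belongs to the coset of `x g`. -/
theorem isHeckeOperator_heckeOperator (hϖ : Irreducible ϖ) {s : 𝓀[F] → 𝒪[F]}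
    (hs : ∀ x, IsLocalRing.residue 𝒪[F] (s x) = x) :
    IsHeckeOperator p ι r hϖ s (heckeOperator hϖ p ι r) := by
  classical
  have := Fintype.ofFinite 𝓀[F]
  intro g v
  refine ⟨stdElt hϖ ι g v, rfl, funext fun x => ?_⟩
  rw [heckeOperator_stdElt, finsum_eq_sum_of_fintype, finsum_eq_sum_of_fintype, Pi.add_apply,
    Finset.sum_apply, Finset.sum_apply]
  have h1 : ∀ l : 𝓀[F] × 𝓀[F], weight p ι r w0 (weightU k r
      (weight p ι r (w0u (s l.1 + s l.2 * ϖ)) v)) = heckeKernel p ι r ϖ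
        (incl F (upper (s l.1 + s l.2 * ϖ)) * (alpha0 hϖ)⁻¹)⁻¹ v := fun l => by
    rw [heckeKernel_upper_inv]; rfl
  have h2 : ∀ m : 𝓀[F], weightU k r v
      = heckeKernel p ι r ϖ (incl F (lower (ϖ * s m)) * alpha0 hϖ)⁻¹ v := fun m => by
    rw [heckeKernel_lower_inv]
  simp only [mul_assoc g]
  by_cases hx : OnSphere ϖ 1 (x * g)
  · rcases hx.exists_eq hϖ with ⟨a, t, ha⟩ | ⟨a, c, ha⟩
    · rw [pow_one] at ha
      obtain ⟨l₀, hl₀⟩ := exists_forall_sq_dvd_iff hϖ hs t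
      have hmem : ∀ l : 𝓀[F] × 𝓀[F], InBall ϖ 0
          (x * g * (incl F (upper (s l.1 + s l.2 * ϖ)) * (alpha0 hϖ)⁻¹)) ↔ l = l₀ := fun l => by
        rw [← hl₀ l, ha, mul_assoc (incl F a), mul_assoc (incl F a), inBall_incl_mul_iff,
          inBall_upper_upper_iff]
      have hnot : ∀ m : 𝓀[F], ¬ InBall ϖ 0
          (x * g * (incl F (lower (ϖ * s m)) * alpha0 hϖ)) := fun m => by
        rw [ha, mul_assoc (incl F a), mul_assoc (incl F a), inBall_incl_mul_iff]
        exact not_inBall_upper_lower hϖ _ _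
      rw [Finset.sum_eq_zero (s := (Finset.univ : Finset 𝓀[F]))
        (fun m _ => stdFun_mul_of_not_inBall (hnot m) _), add_zero, Finset.sum_eq_single l₀
        (fun l _ hl => stdFun_mul_of_not_inBall (mt (hmem l).1 hl) _)
        (fun h => absurd (Finset.mem_univ _) h), h1,
        stdFun_mul_heckeKernel_of_inBall ((hmem l₀).2 rfl)]
    · rw [pow_one] at ha
      have hmem : ∀ m : 𝓀[F], InBall ϖ 0
          (x * g * (incl F (lower (ϖ * s m)) * alpha0 hϖ))
            ↔ m = -IsLocalRing.residue 𝒪[F] c := fun m => by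
        rw [← dvd_add_iff_eq hϖ hs, ha, mul_assoc (incl F a), mul_assoc (incl F a),
          inBall_incl_mul_iff, inBall_lower_lower_iff]
      have hnot : ∀ l : 𝓀[F] × 𝓀[F], ¬ InBall ϖ 0
          (x * g * (incl F (upper (s l.1 + s l.2 * ϖ)) * (alpha0 hϖ)⁻¹)) := fun l => by
        rw [ha, mul_assoc (incl F a), mul_assoc (incl F a), inBall_incl_mul_iff]
        exact not_inBall_lower_upper hϖ _ _
      rw [Finset.sum_eq_zero (s := (Finset.univ : Finset (𝓀[F] × 𝓀[F])))
        (fun l _ => stdFun_mul_of_not_inBall (hnot l) _), zero_add,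
        Finset.sum_eq_single (-IsLocalRing.residue 𝒪[F] c)
        (fun m _ hm => stdFun_mul_of_not_inBall (mt (hmem m).1 hm) _)
        (fun h => absurd (Finset.mem_univ _) h), h2,
        stdFun_mul_heckeKernel_of_inBall ((hmem _).2 rfl)]
  · have hz : ∀ y : GS F, stdFun (incl F) (weight p ι r) (g * y) (heckeKernel p ι r ϖ y⁻¹ v) x
        = 0 := fun y => by
      by_cases hy : InBall ϖ 0 (x * g * y)
      · rw [stdFun_mul_heckeKernel_of_inBall hy, heckeKernel_of_not hx, LinearMap.zero_apply]
      · exact stdFun_mul_of_not_inBall hy _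
    rw [heckeKernel_of_not hx, LinearMap.zero_apply,
      Finset.sum_eq_zero fun l _ => by rw [h1, hz],
      Finset.sum_eq_zero fun m _ => by rw [h2 m, hz], add_zero]

end HeckeFormula

/-! ### The filtration of the compact induction by balls -/

section

variable {F : Type*} [Field F] [ValuativeRel F] {ϖ : 𝒪[F]}

theorem not_inBall_conj_lower (hϖ : Irreducible ϖ) (m : ℕ) :
    ¬ InBall ϖ 0 ((alpha0 hϖ ^ (m + 1))⁻¹ * incl F (lower (ϖ ^ m * ϖ ^ m * ϖ))
      * alpha0 hϖ ^ (m + 1)) := by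
  have h0 := uniformizer_ne_zero hϖ
  intro h
  have h1 := h 1 0
  rw [Matrix.SpecialLinearGroup.coe_mul, Matrix.SpecialLinearGroup.coe_mul, alpha0_pow_val,
    alpha0_pow_inv_val, incl_lower, lower_val, Matrix.mul_fin_two, Matrix.mul_fin_two] at h1
  have h2 : ((ϖ : F) ^ 1)⁻¹ * ((1 : 𝒪[F]) : F) ∈ 𝒪[F] := by
    convert h1 using 1
    simp
    field_simp
    ring
  have h3 := dvd_of_coe_mul_mem hϖ h2
  rw [pow_one] at h3
  exact hϖ.not_isUnit (isUnit_of_dvd_one h3)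

end

section Filtration

variable {F : Type*} [Field F] [ValuativeRel F] [TopologicalSpace F] [IsNonarchimedeanLocalField F]
  {p : ℕ} [Fact p.Prime] [CharP 𝓀[F] p] {k : Type*} [Field k] {ι : 𝓀[F] →+* k} {n : ℕ}
  {r : Fin n → ℕ} {ϖ : 𝒪[F]}

/-- The functions in the compact induction that are supported on elements of level less than `m`. -/
noncomputable def ballFil (p : ℕ) [Fact p.Prime] [CharP 𝓀[F] p] (ι : 𝓀[F] →+* k) (r : Fin n → ℕ)
    (ϖ : 𝒪[F]) (m : ℕ) : Submodule k (CInd (incl F) (weight p ι r)) :=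
  supportedOn (incl F) (weight p ι r) {x | ∃ j < m, InBall ϖ j x}

/-- The functions in the compact induction that are supported on elements of level `m`. -/
noncomputable def sphereFun (p : ℕ) [Fact p.Prime] [CharP 𝓀[F] p] (ι : 𝓀[F] →+* k) (r : Fin n → ℕ)
    (ϖ : 𝒪[F]) (m : ℕ) : Submodule k (CInd (incl F) (weight p ι r)) :=
  supportedOn (incl F) (weight p ι r) {x | OnSphere ϖ m x}

theorem mem_ballFil {m : ℕ} {f : CInd (incl F) (weight p ι r)} :
    f ∈ ballFil p ι r ϖ m ↔ ∀ x, (¬ ∃ j < m, InBall ϖ j x) → f.1.1 x = 0 := Iff.rfl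

theorem mem_ballFil_succ {m : ℕ} {f : CInd (incl F) (weight p ι r)} :
    f ∈ ballFil p ι r ϖ (m + 1) ↔ ∀ x, f.1.1 x ≠ 0 → InBall ϖ m x := by
  simp only [mem_ballFil, exists_lt_succ_inBall_iff]
  exact forall_congr' fun x => not_imp_comm

theorem ballFil_zero : ballFil p ι r ϖ 0 = ⊥ := by
  rw [eq_bot_iff]
  intro f hf
  rw [Submodule.mem_bot]
  refine cInd_ext fun x => hf x ?_
  rintro ⟨j, hj, -⟩
  exact Nat.not_lt_zero _ hj

theorem ballFil_mono : Monotone (ballFil p ι r ϖ) := by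
  intro m l hml f hf x hx
  exact hf x fun ⟨j, hj, h⟩ => hx ⟨j, hj.trans_le hml, h⟩

theorem exists_mem_ballFil (hϖ : Irreducible ϖ) (f : CInd (incl F) (weight p ι r)) :
    ∃ m, f ∈ ballFil p ι r ϖ m := by
  obtain ⟨m, hm⟩ := exists_bound hϖ f
  exact ⟨m + 1, mem_ballFil_succ.2 hm⟩

theorem supportedOn_mono {S T : Set (GS F)} (h : S ⊆ T) :
    supportedOn (incl F) (weight p ι r) S ≤ supportedOn (incl F) (weight p ι r) T :=
  fun _ hf x hx => hf x fun hxS => hx (h hxS)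

theorem supportedOn_union_le (hϖ : Irreducible ϖ) {S T : Set (GS F)}
    (hS : ∀ (a : K0 F) x, incl F a * x ∈ S ↔ x ∈ S) :
    supportedOn (incl F) (weight p ι r) (S ∪ T)
      ≤ supportedOn (incl F) (weight p ι r) S ⊔ supportedOn (incl F) (weight p ι r) T := by
  classical
  intro f hf
  obtain ⟨m, hm⟩ := exists_bound hϖ f
  let f₁ : CInd (incl F) (weight p ι r) := cIndOfBounded hϖ (fun x => if x ∈ S then f.1.1 x else 0)
    (fun a x => by
      simp only [hS]
      split_ifs
      · exact cInd_incl_mul f a x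
      · rw [map_zero]) m
    (fun x hx => hm x fun h => hx (by simp [h]))
  have hf₁ : ∀ x, f₁.1.1 x = if x ∈ S then f.1.1 x else 0 := fun x => rfl
  refine Submodule.mem_sup.2 ⟨f₁, fun x hx => by rw [hf₁, if_neg hx], f - f₁, fun x hx => ?_,
    cInd_ext fun x => ?_⟩
  swap
  · change f₁.1.1 x + (f.1.1 x - f₁.1.1 x) = f.1.1 x
    abel
  change f.1.1 x - f₁.1.1 x = 0
  rw [hf₁]
  split_ifs with h
  · rw [sub_self]
  · rw [sub_zero]
    exact hf x fun h' => h'.elim h hx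

theorem ballFil_sup_sphereFun (hϖ : Irreducible ϖ) (m : ℕ) :
    ballFil p ι r ϖ m ⊔ sphereFun p ι r ϖ m = ballFil p ι r ϖ (m + 1) := by
  apply le_antisymm
  · refine sup_le (ballFil_mono (Nat.le_succ m)) (supportedOn_mono fun x hx => ?_)
    exact ⟨m, Nat.lt_succ_self m, hx.1⟩
  · refine (supportedOn_mono fun x hx => ?_).trans (supportedOn_union_le hϖ fun a x => ?_)
    · by_cases h : ∃ j < m, InBall ϖ j x
      · exact Or.inl h
      · exact Or.inr ⟨exists_lt_succ_inBall_iff.1 hx, fun j hj hb => h ⟨j, hj, hb⟩⟩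
    · simp only [Set.mem_ofPred_eq, inBall_incl_mul_iff]

theorem incl_mul_mem_cell_iff (hϖ : Irreducible ϖ) (m : ℤ) (a : K0 F) (x : GS F) :
    incl F a * x ∈ cell hϖ m ↔ x ∈ cell hϖ m := by
  constructor
  · rintro ⟨a', b, hb, h⟩
    refine ⟨a⁻¹ * a', b, hb, ?_⟩
    rw [← inv_mul_cancel_left (incl F a) x, h, map_mul, map_inv, mul_assoc, mul_assoc, mul_assoc]
  · rintro ⟨a', b, hb, rfl⟩
    exact ⟨a * a', b, hb, by rw [map_mul, mul_assoc, mul_assoc, mul_assoc]⟩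

theorem sphereFun_le_sphere (hϖ : Irreducible ϖ) (m : ℕ) :
    sphereFun p ι r ϖ m ≤ sphere (weight p ι r) hϖ m := by
  refine (supportedOn_mono fun x hx => ?_).trans
    (supportedOn_union_le hϖ (incl_mul_mem_cell_iff hϖ m))
  rcases OnSphere.exists_eq hϖ hx with ⟨a, t, rfl⟩ | ⟨a, c, rfl⟩
  · refine Or.inl ⟨a, upper t, ⟨?_, ?_, ?_⟩, by rw [zpow_natCast]⟩ <;> simp [upper]
  · refine Or.inr ⟨a, lower (ϖ * c), ⟨?_, ?_, ?_⟩, by rw [_root_.zpow_neg, zpow_natCast]⟩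
    · simp [lower]
    · simpa [lower] using Ideal.mul_mem_right c _
        ((IsLocalRing.mem_maximalIdeal ϖ).2 hϖ.not_isUnit)
    · simp [lower]

theorem heckeOperator_mem_ballFil (hϖ : Irreducible ϖ) (m : ℕ) (f : CInd (incl F) (weight p ι r))
    (hf : f ∈ ballFil p ι r ϖ m) : heckeOperator hϖ p ι r f ∈ ballFil p ι r ϖ (m + 1) := by
  rcases m with _ | m
  · rw [ballFil_zero, Submodule.mem_bot] at hf
    rw [hf, map_zero]
    exact zero_mem _
  · exact mem_ballFil_succ.2 (inBall_of_heckeFun_ne_zero hϖ (mem_ballFil_succ.1 hf))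

/-- The values of `τ f` at the children of a vertex on the boundary of the support of `f`: by
uniqueness of the parent, only one value of `f` contributes. -/
theorem heckeOperator_apply_child (hϖ : Irreducible ϖ) {m : ℕ} {f : CInd (incl F) (weight p ι r)}
    (hf : f ∈ ballFil p ι r ϖ (m + 1)) (b : K0 F) (t : 𝒪[F]) :
    (heckeOperator hϖ p ι r f).1.1
        ((alpha0 hϖ ^ (m + 1))⁻¹ * incl F (lower (ϖ ^ m * ϖ ^ m * t)) * incl F b)
      = weightU k r (weight p ι r (lower t) (f.1.1 ((alpha0 hϖ ^ m)⁻¹ * incl F b))) := by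
  have hy : ((alpha0 hϖ)⁻¹ * incl F (lower t))⁻¹
      * ((alpha0 hϖ ^ (m + 1))⁻¹ * incl F (lower (ϖ ^ m * ϖ ^ m * t)) * incl F b)
      = (alpha0 hϖ ^ m)⁻¹ * incl F b := by
    have h := alpha0_pow_inv_mul_lower hϖ m t
    have h' : (alpha0 hϖ ^ (m + 1))⁻¹ = (alpha0 hϖ)⁻¹ * (alpha0 hϖ ^ m)⁻¹ := by
      rw [pow_succ, _root_.mul_inv_rev]
    rw [h', mul_assoc (alpha0 hϖ)⁻¹, h]
    group
  rw [heckeOperator_apply_eq hϖ f _ ((alpha0 hϖ)⁻¹ * incl F (lower t)), hy, heckeKernel_mul_incl,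
    heckeKernel_alpha0_inv, Module.End.mul_apply]
  intro z hz hfz
  have h1 := mem_ballFil_succ.1 hf _ hfz
  rw [← mul_assoc, inBall_mul_incl_iff, ← mul_assoc, inBall_mul_incl_iff] at h1
  obtain ⟨a, ha⟩ := eq_of_inBall_of_inBall_mul_inv hϖ h1 (by
    rwa [_root_.mul_inv_rev, inv_inv, inv_inv, inv_mul_cancel_left])
  refine ⟨(lower t)⁻¹ * a⁻¹, ?_⟩
  rw [inv_mul_eq_iff_eq_mul, ← mul_assoc, eq_mul_inv_iff_mul_eq] at ha
  have h2 : z = (alpha0 hϖ ^ (m + 1))⁻¹ * alpha0 hϖ ^ m * (incl F a)⁻¹ := by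
    rw [ha]; group
  rw [h2, map_mul, map_inv, map_inv, pow_succ]
  group

theorem eq_zero_of_weightU_lower (hn : Nat.card 𝓀[F] = p ^ n) (hr : ∀ i, r i < p)
    {w : WeightSpace k r} (h : ∀ t, weightU k r (weight p ι r (lower t) w) = 0) : w = 0 := by
  rw [eq_smul_of_coord_lower (ι := ι) hn hr (w := w) (c := 0) fun t => ?_, zero_smul]
  have h1 := h t
  rw [weightU_apply, smul_eq_zero] at h1
  exact h1.resolve_right ((weightBasis k r).ne_zero 0)

/-- `τ` moves the support of every function strictly outwards. -/
theorem mem_ballFil_of_heckeOperator (hϖ : Irreducible ϖ) (hn : Nat.card 𝓀[F] = p ^ n)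
    (hr : ∀ i, r i < p) (m : ℕ) (f : CInd (incl F) (weight p ι r))
    (hf : f ∈ ballFil p ι r ϖ (m + 1))
    (hτf : heckeOperator hϖ p ι r f ∈ ballFil p ι r ϖ (m + 1)) : f ∈ ballFil p ι r ϖ m := by
  intro x hx
  by_contra hfx
  have hs : OnSphere ϖ m x := ⟨mem_ballFil_succ.1 hf x hfx, fun j hj hb => hx ⟨j, hj, hb⟩⟩
  obtain ⟨a, b, rfl⟩ := hs.exists_cartan hϖ
  rw [mul_assoc, cInd_incl_mul_eq_zero_iff] at hfx
  refine hfx (eq_zero_of_weightU_lower (ι := ι) hn hr fun t => ?_)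
  rw [← heckeOperator_apply_child hϖ hf]
  exact hτf _ (onSphere_child hϖ (m + 1) _ b).not_exists_inBall

theorem stdElt_mem_ballFil (hϖ : Irreducible ϖ) {m : ℕ} {g : GS F} (hg : InBall ϖ m g)
    (v : WeightSpace k r) : stdElt hϖ ι g v ∈ ballFil p ι r ϖ (m + 1) :=
  mem_ballFil_succ.2 fun _ => inBall_of_stdFun_ne_zero hg

theorem stdElt_apply_inv (hϖ : Irreducible ϖ) (g : GS F) (v : WeightSpace k r) :
    (stdElt (p := p) hϖ ι g v).1.1 g⁻¹ = v := by
  rw [stdElt_apply, stdFun_apply_of_eq (a := 1) (by rw [map_one, inv_mul_cancel]), map_one,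
    Module.End.one_apply]

/-- The functions `τ f` with `f` of level less than `m` do not account for all functions of level
`m`: they take the same value at siblings that are congruent to each other. -/
theorem ballFil_sup_map_ne (hϖ : Irreducible ϖ) (m : ℕ) :
    ballFil p ι r ϖ m ⊔ (ballFil p ι r ϖ m).map (heckeOperator hϖ p ι r).toLinearMap
      ≠ ballFil p ι r ϖ (m + 1) := by
  intro heq
  rcases m with _ | m
  · have h1 : stdElt hϖ ι 1 (weightBasis k r 0) ∈ ballFil p ι r ϖ (0 + 1) :=
      stdElt_mem_ballFil hϖ (by simpa using inBall_incl (ϖ := ϖ) (1 : K0 F)) _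
    rw [← heq, ballFil_zero, Submodule.map_bot, sup_bot_eq, Submodule.mem_bot] at h1
    have h2 := stdElt_apply_inv (p := p) (ι := ι) hϖ 1 (weightBasis k r 0)
    rw [h1] at h2
    exact (weightBasis k r).ne_zero 0 h2.symm
  · let P : 𝒪[F] → GS F := fun t =>
      (alpha0 hϖ ^ (m + 1))⁻¹ * incl F (lower (ϖ ^ m * ϖ ^ m * t)) * incl F 1
    have hP : ∀ t, OnSphere ϖ (m + 1) (P t) := fun t => onSphere_child hϖ (m + 1) _ 1
    have hP0 : P 0 = (alpha0 hϖ ^ (m + 1))⁻¹ := by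
      have h1 : (lower (0 : 𝒪[F]) : K0 F) = 1 := by
        refine Matrix.SpecialLinearGroup.ext _ _ fun i j => ?_
        fin_cases i <;> fin_cases j <;> simp [lower]
      simp only [P, mul_zero, h1, map_one, mul_one]
    have hle : ballFil p ι r ϖ (m + 1) ⊔
        (ballFil p ι r ϖ (m + 1)).map (heckeOperator hϖ p ι r).toLinearMap
        ≤ LinearMap.eqLocus
          (((LinearMap.proj (P 0)).comp (Submodule.subtype _)).comp (Submodule.subtype _) :
            CInd (incl F) (weight p ι r) →ₗ[k] WeightSpace k r)
          (((LinearMap.proj (P ϖ)).comp (Submodule.subtype _)).comp (Submodule.subtype _)) := by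
      refine sup_le (fun f hf => ?_) ?_
      · change f.1.1 (P 0) = f.1.1 (P ϖ)
        rw [hf _ (hP 0).not_exists_inBall, hf _ (hP ϖ).not_exists_inBall]
      · rintro _ ⟨f, hf, rfl⟩
        change (heckeOperator hϖ p ι r f).1.1 (P 0) = (heckeOperator hϖ p ι r f).1.1 (P ϖ)
        rw [heckeOperator_apply_child hϖ hf, heckeOperator_apply_child hϖ hf, weight_lower,
          weight_lower, (dvd_iff_residue_eq_zero hϖ ϖ).1 dvd_rfl, map_zero]
    have h1 : stdElt hϖ ι (alpha0 hϖ ^ (m + 1)) (weightBasis k r 0)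
        ∈ ballFil p ι r ϖ (m + 1 + 1) :=
      stdElt_mem_ballFil hϖ (onSphere_alpha0_pow hϖ (m + 1)).1 _
    rw [← heq] at h1
    have h2 : (stdElt (p := p) hϖ ι (alpha0 hϖ ^ (m + 1)) (weightBasis k r 0)).1.1 (P 0)
        = (stdElt (p := p) hϖ ι (alpha0 hϖ ^ (m + 1)) (weightBasis k r 0)).1.1 (P ϖ) := hle h1
    rw [hP0, stdElt_apply_inv, stdElt_apply, stdFun_apply_of_not_exists] at h2
    · exact (weightBasis k r).ne_zero 0 h2
    · rw [← inBall_zero_iff (ϖ := ϖ)]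
      simp only [P, map_one, mul_one]
      exact not_inBall_conj_lower hϖ m

end Filtration

/-! ### The structure of the Hecke algebra -/

section Symbol

variable {F : Type*} [Field F] [ValuativeRel F] [TopologicalSpace F] [IsNonarchimedeanLocalField F]
  {p : ℕ} [Fact p.Prime] [CharP 𝓀[F] p] {k : Type*} [Field k] {ι : 𝓀[F] →+* k} {n : ℕ}
  {r : Fin n → ℕ} {ϖ : 𝒪[F]}

theorem weight_lower_mul_weightU (t : 𝒪[F]) :
    weight p ι r (lower t) * weightU k r = weightU k r := by
  rw [← weightMat_diag p ι r, ← weightMat_coe, ← map_mul]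
  congr 1
  rw [lower_val, Matrix.mul_fin_two]
  simp

theorem weightU_basis_zero : weightU k r (weightBasis k r 0) = weightBasis k r 0 := by
  rw [weightU_apply, Module.Basis.repr_self, Finsupp.single_eq_same, one_smul]

/-- An endomorphism that factors through the coinvariants of the upper unipotent group and the
invariants of the lower one is a multiple of `U_r`. -/
theorem exists_eq_smul_weightU (hn : Nat.card 𝓀[F] = p ^ n) (hr : ∀ i, r i < p)
    {S : Module.End k (WeightSpace k r)} (hu : ∀ t, S * weight p ι r (upper t) = S)
    (hl : ∀ t, weight p ι r (lower t) * S = S) : ∃ c : k, S = c • weightU k r := by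
  have h1 : ∀ w, S w = (weightBasis k r).repr (S w) 0 • weightBasis k r 0 := fun w =>
    eq_smul_of_coord_lower (ι := ι) hn hr fun t => by
      rw [← Module.End.mul_apply, hl]
  have h2 := eq_smul_coord_of_upper (ι := ι) hn hr (μ := ((weightBasis k r).coord 0).comp S)
    (c := (weightBasis k r).coord 0 (S (weightBasis k r 0))) fun t => by
      rw [LinearMap.comp_apply, ← Module.End.mul_apply, hu]
  refine ⟨(weightBasis k r).coord 0 (S (weightBasis k r 0)), LinearMap.ext fun w => ?_⟩
  rw [h1, LinearMap.smul_apply, weightU_apply, smul_smul]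
  exact congrArg (· • weightBasis k r 0) (LinearMap.congr_fun h2 w)

/-- Schur's lemma for the weight. It holds over any field `k`, because the invariants of the lower
unipotent group are a line that generates the weight. -/
theorem exists_eq_smul_one (hn : Nat.card 𝓀[F] = p ^ n) (hr : ∀ i, r i < p)
    {S : Module.End k (WeightSpace k r)} (hS : ∀ a, S * weight p ι r a = weight p ι r a * S) :
    ∃ c : k, S = c • 1 := by
  have hS' : ∀ a w, S (weight p ι r a w) = weight p ι r a (S w) := fun a =>
    LinearMap.congr_fun (hS a)
  have h0 : ∀ t, weight p ι r (lower t) (weightBasis k r 0) = weightBasis k r 0 := fun t => by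
    rw [← weightU_basis_zero, ← Module.End.mul_apply, weight_lower_mul_weightU]
  set c := (weightBasis k r).repr (S (weightBasis k r 0)) 0 with hc
  have h1 : S (weightBasis k r 0) = c • weightBasis k r 0 :=
    eq_smul_of_coord_lower (ι := ι) hn hr fun t => by rw [← hS', h0]
  have h2 : ((weightBasis k r).coord 0).comp (S - c • 1) = 0 := by
    refine (eq_smul_coord_of_upper (ι := ι) hn hr (c := 0) fun t => ?_).trans (zero_smul _ _)
    rw [LinearMap.comp_apply, LinearMap.sub_apply, hS', h1, map_smul, LinearMap.smul_apply,
      Module.End.one_apply, sub_self, map_zero]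
  refine ⟨c, sub_eq_zero.1 (LinearMap.ext fun w => ?_)⟩
  rw [eq_smul_of_coord_lower (ι := ι) hn hr (w := (S - c • 1) w) (c := 0) fun t => ?_, zero_smul,
    LinearMap.zero_apply]
  have h3 : weight p ι r (lower t) ((S - c • 1) w) = (S - c • 1) (weight p ι r (lower t) w) := by
    rw [LinearMap.sub_apply, LinearMap.sub_apply, map_sub, hS', LinearMap.smul_apply,
      LinearMap.smul_apply, map_smul, Module.End.one_apply, Module.End.one_apply]
  rw [h3]
  exact LinearMap.congr_fun h2 _

/-- The kernel of the Hecke operator `T` at `x`, as an endomorphism of the weight: by Frobenius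
reciprocity, `T` is convolution with this function. -/
noncomputable def symbol (hϖ : Irreducible ϖ) (T : HeckeAlgebra (incl F) (weight p ι r))
    (x : GS F) :
    Module.End k (WeightSpace k r) where
  toFun v := (T (stdElt hϖ ι 1 v)).1.1 x
  map_add' v w := by rw [stdElt_add, map_add]; rfl
  map_smul' c v := by rw [stdElt_smul, map_smul]; rfl

theorem symbol_incl_mul (hϖ : Irreducible ϖ) (T : HeckeAlgebra (incl F) (weight p ι r)) (a : K0 F)
    (x : GS F) : symbol hϖ T (incl F a * x) = weight p ι r a * symbol hϖ T x :=
  LinearMap.ext fun _ => cInd_incl_mul _ a x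

theorem symbol_mul_incl (hϖ : Irreducible ϖ) (T : HeckeAlgebra (incl F) (weight p ι r)) (a : K0 F)
    (x : GS F) : symbol hϖ T (x * incl F a) = symbol hϖ T x * weight p ι r a := by
  refine LinearMap.ext fun v => ?_
  change (T (stdElt hϖ ι 1 v)).1.1 (x * incl F a) = (T (stdElt hϖ ι 1 (weight p ι r a v))).1.1 x
  rw [← stdElt_incl, stdElt_eq hϖ (incl F a), T.isIntertwining, cInd_apply]

/-- Conjugation by `α₀^(-(m+1))` moves the upper unipotent integral matrices, and its inverse
moves the lower ones, into the kernel of the weight. So the symbol at this element is invariant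
under both. -/
theorem exists_symbol_eq_smul_weightU (hϖ : Irreducible ϖ) (hn : Nat.card 𝓀[F] = p ^ n)
    (hr : ∀ i, r i < p) (T : HeckeAlgebra (incl F) (weight p ι r)) (m : ℕ) :
    ∃ c : k, symbol hϖ T (alpha0 hϖ ^ (m + 1))⁻¹ = c • weightU k r := by
  have hone : ∀ {a : K0 F}, (∀ i j, ∃ c, a.1 i j = (1 : Matrix (Fin 2) (Fin 2) 𝒪[F]) i j + ϖ * c) →
      weight p ι r a = 1 := weight_eq_one hϖ
  refine exists_eq_smul_weightU (ι := ι) hn hr (fun t => ?_) fun t => ?_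
  · rw [← symbol_mul_incl, alpha0_pow_inv_mul_upper, symbol_incl_mul, hone, one_mul]
    intro i j
    fin_cases i <;> fin_cases j
    · exact ⟨0, by simp [upper]⟩
    · exact ⟨ϖ ^ m * ϖ ^ (m + 1) * t, by simp [upper]; ring⟩
    · exact ⟨0, by simp [upper]⟩
    · exact ⟨0, by simp [upper]⟩
  · rw [← symbol_incl_mul, ← alpha0_pow_inv_mul_lower, symbol_mul_incl, hone, mul_one]
    intro i j
    fin_cases i <;> fin_cases j
    · exact ⟨0, by simp [lower]⟩
    · exact ⟨0, by simp [lower]⟩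
    · exact ⟨ϖ ^ m * ϖ ^ (m + 1) * t, by simp [lower]; ring⟩
    · exact ⟨0, by simp [lower]⟩

/-- By the Cartan decomposition and equivariance, a symbol that vanishes at `α₀^(-m)` vanishes at
all elements of level `m`. -/
theorem mem_ballFil_of_symbol_eq_zero (hϖ : Irreducible ϖ)
    {T : HeckeAlgebra (incl F) (weight p ι r)} {m : ℕ}
    (hT : ∀ v, T (stdElt hϖ ι 1 v) ∈ ballFil p ι r ϖ (m + 1))
    (h0 : symbol hϖ T (alpha0 hϖ ^ m)⁻¹ = 0) (v : WeightSpace k r) :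
    T (stdElt hϖ ι 1 v) ∈ ballFil p ι r ϖ m := by
  intro x hx
  by_contra hne
  obtain ⟨a, b, rfl⟩ := OnSphere.exists_cartan hϖ (m := m) (g := x)
    ⟨mem_ballFil_succ.1 (hT v) x hne, fun j hj hb => hx ⟨j, hj, hb⟩⟩
  refine hne (?_ : symbol hϖ T _ v = 0)
  rw [symbol_mul_incl, symbol_incl_mul, h0, mul_zero, zero_mul, LinearMap.zero_apply]

theorem heckeOperator_pow_succ_apply (hϖ : Irreducible ϖ) (m : ℕ)
    (f : CInd (incl F) (weight p ι r)) : (heckeOperator hϖ p ι r ^ (m + 1)) f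
      = heckeOperator hϖ p ι r ((heckeOperator hϖ p ι r ^ m) f) := by
  rw [pow_succ']
  rfl

theorem stdElt_one_mem_ballFil (hϖ : Irreducible ϖ) (v : WeightSpace k r) :
    stdElt hϖ ι 1 v ∈ ballFil p ι r ϖ 1 :=
  stdElt_mem_ballFil hϖ (by simpa using inBall_incl (ϖ := ϖ) (1 : K0 F)) v

theorem heckeOperator_pow_mem_ballFil (hϖ : Irreducible ϖ) (m : ℕ) (v : WeightSpace k r) :
    (heckeOperator hϖ p ι r ^ m) (stdElt hϖ ι 1 v) ∈ ballFil p ι r ϖ (m + 1) := by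
  induction m with
  | zero => exact stdElt_one_mem_ballFil hϖ v
  | succ m ih =>
    rw [heckeOperator_pow_succ_apply]
    exact heckeOperator_mem_ballFil hϖ _ _ ih

theorem heckeOperator_pow_not_mem_ballFil (hϖ : Irreducible ϖ) (hn : Nat.card 𝓀[F] = p ^ n)
    (hr : ∀ i, r i < p) (m : ℕ) {v : WeightSpace k r} (hv : v ≠ 0) :
    (heckeOperator hϖ p ι r ^ m) (stdElt hϖ ι 1 v) ∉ ballFil p ι r ϖ m := by
  induction m with
  | zero =>
    intro h
    have h1 : stdElt hϖ ι 1 v ∈ ballFil p ι r ϖ 0 := h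
    rw [ballFil_zero, Submodule.mem_bot] at h1
    have h2 := stdElt_apply_inv (p := p) (ι := ι) hϖ 1 v
    rw [h1] at h2
    exact hv h2.symm
  | succ m ih =>
    intro h
    rw [heckeOperator_pow_succ_apply] at h
    exact ih (strict_of_mem (V := CInd (incl F) (weight p ι r)) (Fil := ballFil p ι r ϖ)
      (τ := (heckeOperator hϖ p ι r).toLinearMap)
      (ballFil_mono (p := p) (ι := ι) (r := r)) (exists_mem_ballFil (p := p) (ι := ι) (r := r) hϖ)
      (mem_ballFil_of_heckeOperator hϖ hn hr) h)

/-- On each double coset, the symbols of Hecke operators form a space of dimension at most one,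
and a power of `τ` has a non-zero symbol there. -/
theorem exists_symbol_eq_smul (hϖ : Irreducible ϖ) (hn : Nat.card 𝓀[F] = p ^ n)
    (hr : ∀ i, r i < p) (T : HeckeAlgebra (incl F) (weight p ι r)) (m : ℕ) :
    ∃ c : k, symbol hϖ T (alpha0 hϖ ^ m)⁻¹
      = c • symbol hϖ (heckeOperator hϖ p ι r ^ m) (alpha0 hϖ ^ m)⁻¹ := by
  rcases m with _ | m
  · have h1 : symbol hϖ (heckeOperator hϖ p ι r ^ 0) (alpha0 hϖ ^ 0)⁻¹ = 1 :=
      LinearMap.ext fun v => stdElt_apply_inv hϖ 1 v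
    rw [h1]
    refine exists_eq_smul_one (ι := ι) hn hr fun a => ?_
    rw [← symbol_mul_incl, ← symbol_incl_mul, pow_zero, inv_one, one_mul, mul_one]
  · obtain ⟨c, hc⟩ := exists_symbol_eq_smul_weightU hϖ hn hr T m
    obtain ⟨d, hd⟩ := exists_symbol_eq_smul_weightU hϖ hn hr (heckeOperator hϖ p ι r ^ (m + 1)) m
    have hd0 : d ≠ 0 := by
      rintro rfl
      rw [zero_smul] at hd
      exact heckeOperator_pow_not_mem_ballFil hϖ hn hr (m + 1) ((weightBasis k r).ne_zero 0)
        (mem_ballFil_of_symbol_eq_zero hϖ (heckeOperator_pow_mem_ballFil hϖ (m + 1)) hd _)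
    exact ⟨c * d⁻¹, by rw [hc, hd, smul_smul, inv_mul_cancel_right₀ hd0]⟩

/-- A Hecke operator of level less than `m` is a polynomial in `τ`: subtract a multiple of a power
of `τ` with the same symbol on the outermost double coset. -/
theorem exists_aeval_heckeOperator_eq_of_mem (hϖ : Irreducible ϖ) (hn : Nat.card 𝓀[F] = p ^ n)
    (hr : ∀ i, r i < p) (m : ℕ) (T : HeckeAlgebra (incl F) (weight p ι r))
    (hT : ∀ v, T (stdElt hϖ ι 1 v) ∈ ballFil p ι r ϖ m) :
    ∃ P : Polynomial k, Polynomial.aeval (heckeOperator hϖ p ι r) P = T := by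
  induction m generalizing T with
  | zero =>
    refine ⟨0, (map_zero _).trans (heckeAlgebra_ext hϖ fun v => ?_)⟩
    have h := hT v
    rw [ballFil_zero, Submodule.mem_bot] at h
    exact h.symm
  | succ m ih =>
    obtain ⟨c, hc⟩ := exists_symbol_eq_smul hϖ hn hr T m
    obtain ⟨P, hP⟩ := ih (T + (-c) • heckeOperator hϖ p ι r ^ m)
      (mem_ballFil_of_symbol_eq_zero hϖ
        (fun v => add_mem (hT v)
          (Submodule.smul_mem _ (-c) (heckeOperator_pow_mem_ballFil hϖ m v))) (by
        have h : symbol hϖ (T + (-c) • heckeOperator hϖ p ι r ^ m) (alpha0 hϖ ^ m)⁻¹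
            = symbol hϖ T (alpha0 hϖ ^ m)⁻¹
              + (-c) • symbol hϖ (heckeOperator hϖ p ι r ^ m) (alpha0 hϖ ^ m)⁻¹ := rfl
        rw [h, hc, neg_smul, add_neg_cancel]))
    refine ⟨P + c • Polynomial.X ^ m, ?_⟩
    rw [map_add, map_smul, map_pow, Polynomial.aeval_X, hP, add_assoc, ← add_smul, neg_add_cancel,
      zero_smul, add_zero]

theorem aeval_heckeOperator_surjective (hϖ : Irreducible ϖ) (hn : Nat.card 𝓀[F] = p ^ n)
    (hr : ∀ i, r i < p) : Function.Surjective
      (Polynomial.aeval (heckeOperator hϖ p ι r) :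
        Polynomial k →ₐ[k] HeckeAlgebra (incl F) (weight p ι r)) := by
  intro T
  choose N hN using fun l =>
    exists_mem_ballFil hϖ (T (stdElt hϖ ι 1 (weightBasis k r l)))
  let L : WeightSpace k r →ₗ[k] CInd (incl F) (weight p ι r) :=
    { toFun := fun v => T (stdElt hϖ ι 1 v)
      map_add' := fun v w => by rw [stdElt_add, map_add]
      map_smul' := fun c v => by rw [stdElt_smul, map_smul]; rfl }
  have hL : LinearMap.range L ≤ ballFil p ι r ϖ (Finset.univ.sup N) := by
    rw [LinearMap.range_eq_map, ← (weightBasis k r).span_eq, Submodule.map_span_le]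
    rintro _ ⟨l, rfl⟩
    exact ballFil_mono (Finset.le_sup (Finset.mem_univ l)) (hN l)
  exact exists_aeval_heckeOperator_eq_of_mem hϖ hn hr _ T fun v => hL ⟨v, rfl⟩

end Symbol

/-! ### The basis of the compact induction -/

section Basis

variable {F : Type*} [Field F] [ValuativeRel F] [TopologicalSpace F] [IsNonarchimedeanLocalField F]
  {p : ℕ} [Fact p.Prime] [CharP 𝓀[F] p] {k : Type*} [Field k] {ι : 𝓀[F] →+* k} {n : ℕ}
  {r : Fin n → ℕ} {ϖ : 𝒪[F]}

theorem aeval_apply_eq (T : HeckeAlgebra (incl F) (weight p ι r)) (P : Polynomial k)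
    (f : CInd (incl F) (weight p ι r)) :
    Polynomial.aeval T P f = Polynomial.aeval (R := k) T.toLinearMap P f := by
  have h : ∀ m : ℕ, (T ^ m).toLinearMap = T.toLinearMap ^ m := by
    intro m
    induction m with
    | zero => rfl
    | succ m ih => rw [pow_succ, pow_succ, ← ih]; rfl
  induction P using Polynomial.induction_on' with
  | add P Q hP hQ =>
    rw [map_add, map_add, LinearMap.add_apply, ← hP, ← hQ]
    rfl
  | monomial m c =>
    rw [Polynomial.aeval_monomial, Polynomial.aeval_monomial, ← h]
    rfl

theorem heckeOperator_injective (hϖ : Irreducible ϖ) (hn : Nat.card 𝓀[F] = p ^ n)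
    (hr : ∀ i, r i < p) : Function.Injective (heckeOperator hϖ p ι r).toLinearMap :=
  injective_of_strict (V := CInd (incl F) (weight p ι r)) (Fil := ballFil p ι r ϖ)
    (ballFil_zero (p := p) (ι := ι) (r := r))
    (ballFil_mono (p := p) (ι := ι) (r := r)) (exists_mem_ballFil (p := p) (ι := ι) (r := r) hϖ)
    (mem_ballFil_of_heckeOperator hϖ hn hr)

end Basis

end ModPSL2

open ModPSL2 in
theorem theorem1 (p : ℕ) [Fact p.Prime]
    (F : Type*) [Field F] [ValuativeRel F] [TopologicalSpace F] [IsNonarchimedeanLocalField F]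
    [CharP 𝓀[F] p]
    (k : Type*) [Field k] [Algebra (ZMod p) k] [IsAlgClosure (ZMod p) k] (ι : 𝓀[F] →+* k)
    (n : ℕ) (hn : Nat.card 𝓀[F] = p ^ n) (r : Fin n → ℕ) (hr : ∀ i, r i < p)
    (ϖ : 𝒪[F]) (hϖ : Irreducible ϖ) :
    Module.Free (HeckeAlgebra (incl F) (weight p ι r)) (CInd (incl F) (weight p ι r)) ∧
    Cardinal.aleph0 ≤
      Module.rank (HeckeAlgebra (incl F) (weight p ι r)) (CInd (incl F) (weight p ι r)) ∧
    (∃ τ : HeckeAlgebra (incl F) (weight p ι r),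
      (∀ s : 𝓀[F] → 𝒪[F], (∀ x, IsLocalRing.residue 𝒪[F] (s x) = x) →
        IsHeckeOperator p ι r hϖ s τ) ∧
      Function.Bijective
        (Polynomial.aeval τ : Polynomial k →ₐ[k] HeckeAlgebra (incl F) (weight p ι r))) ∧
    ∃ A : ℕ → Set (CInd (incl F) (weight p ι r)),
      (∀ m, (A m).Nonempty ∧ A m ⊆ sphere (weight p ι r) hϖ m) ∧
      ∃ b : Module.Basis (⋃ m, A m : Set (CInd (incl F) (weight p ι r)))
        (HeckeAlgebra (incl F) (weight p ι r)) (CInd (incl F) (weight p ι r)),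
        ∀ a, b a = a := by
  obtain ⟨A, hAC, hAFil, hind, hgen⟩ := exists_generators
    (V := CInd (incl F) (weight p ι r)) (Fil := ballFil p ι r ϖ)
    (C := sphereFun p ι r ϖ) (τ := (heckeOperator hϖ p ι r).toLinearMap)
    (ballFil_zero (p := p) (ι := ι) (r := r)) (ballFil_mono (p := p) (ι := ι) (r := r))
    (exists_mem_ballFil (p := p) (ι := ι) (r := r) hϖ)
    (ballFil_sup_sphereFun (p := p) (ι := ι) (r := r) hϖ) (heckeOperator_mem_ballFil hϖ)
    (mem_ballFil_of_heckeOperator hϖ hn hr) (ballFil_sup_map_ne hϖ)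
  have hinj := heckeOperator_injective (p := p) (ι := ι) hϖ hn hr
  have hbij : Function.Bijective (Polynomial.aeval (heckeOperator hϖ p ι r) :
      Polynomial k →ₐ[k] HeckeAlgebra (incl F) (weight p ι r)) := by
    refine ⟨(injective_iff_map_eq_zero _).2 fun P hP => ?_, aeval_heckeOperator_surjective hϖ hn hr⟩
    obtain ⟨a, ha⟩ := (hAC 0).1
    refine eq_zero_of_sum_aeval_eq_zero hinj hind {a}
      (by simpa using ⟨0, ha⟩) (fun _ => P) ?_ a (Finset.mem_singleton_self a)
    rw [Finset.sum_singleton, ← aeval_apply_eq, hP]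
    rfl
  obtain ⟨b, hb⟩ := exists_basis_of_polynomial hinj hind hgen (RingEquiv.ofBijective _ hbij)
    (aeval_apply_eq (heckeOperator hϖ p ι r))
  refine ⟨Module.Free.of_basis b, ?_, ⟨heckeOperator hϖ p ι r,
    fun s hs => isHeckeOperator_heckeOperator hϖ hs, hbij⟩, A, fun m => ⟨(hAC m).1,
    (hAC m).2.trans (sphereFun_le_sphere hϖ m)⟩, b, hb⟩
  -- Elements of `A m` for different `m` are distinct, since they have different levels.
  have hinf : Infinite (⋃ m, A m : Set (CInd (incl F) (weight p ι r))) := by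
    choose a ha using fun m => (hAC m).1
    refine Infinite.of_injective
      (fun m => (⟨a m, Set.mem_iUnion.2 ⟨m, ha m⟩⟩ : (⋃ m, A m : Set _)))
      (Function.Injective.of_lt_imp_ne fun m l hml h => hAFil l (a l) (ha l) ?_)
    have h' : a m = a l := congrArg Subtype.val h
    rw [← h']
    refine ballFil_mono (Nat.succ_le_of_lt hml) ?_
    rw [← ballFil_sup_sphereFun hϖ]
    exact Submodule.mem_sup_right ((hAC m).2 (ha m))
  have : Nontrivial (HeckeAlgebra (incl F) (weight p ι r)) :=
    hbij.1.nontrivial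
  exact (Cardinal.aleph0_le_mk _).trans b.linearIndependent.cardinal_le_rank
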